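/- Let $\mathbb{Q}^+$ be the set of nonnegative rationals and $\mathsf{Var}$ a countably infinite set of program variables. Probabilistic programs are given by $$P ::= v := e \;\mid\; P;P \;\mid\; \{P\}\,[p]\,\{P\} \;\mid\; \mathtt{WHILE}\,(b)\,\{P\},$$ where $v\in\mathsf{Var}$, $p\in[0,1]\cap\mathbb{Q}$, $e$ is an arithmetical expression (built from variables and rational constants by $+,-,\cdot$), and $b$ is a Boolean expression (built from comparisons $e=e'$, $e<e'$ by Boolean connectives). A valuation is a map $\eta\colon\mathsf{Var}\to\mathbb{Q}^+$ with $\eta(x)=0$ for all but finitely many $x$. A program is executed in single steps on states $\langle P,\eta,a,\theta\rangle$, where $P$ is the program still to be executed ($\downarrow$ if execution has terminated), $a$ is the probability of the probabilistic choices made so far, and $\theta\in\{L,R\}^*$ records these choices: $v:=e$ sets $v$ to $\max\{[\![e]\!]_\eta,0\}$ and terminates; $P_1;P_2$ performs the steps of $P_1$ and, once $\downarrow;P_2$ is reached, one further step to $P_2$; $\{P_1\}[p]\{P_2\}$ steps to $P_1$, multiplying $a$ by $p$ and appending $L$ to $\theta$, or to $P_2$, multiplying $a$ by $1-p$ and appending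 $R$ to $\theta$; $\mathtt{WHILE}(b)\{P\}$ steps to $P;\mathtt{WHILE}(b)\{P\}$ if $b$ holds and to $\downarrow$ otherwise. For $k\in\mathbb{N}$ and $w\in\{L,R\}^*$ let $T_k(\sigma,w)$ be the state reached from $\sigma$ after exactly $k$ steps among which exactly $|w|$ are probabilistic choices, resolved according to $w$ (and $\bot$ if there is none). The expected outcome of $v$ after executing $P$ on $\eta$ is $$\mathrm{E}_{P,\eta}(v)=\sum_{k=0}^{\infty}\ \sum_{w\in\{L,R\}^{\le k}}\wp\big(T_k(\langle P,\eta,1,\varepsilon\rangle,w),v\big)\in[0,\infty],$$ where $\wp(\langle\downarrow,\eta',a,\theta\rangle,v)=\eta'(v)\cdot a$ and $\wp(\sigma,v)=0$ for every other $\sigma$ and for $\sigma=\bot$. Let $\mathcal{REXP}$ be the set of all tuples $(P,\eta,v,q)$, with $P$ a probabilistic program, $\eta$ a valuation, $v\in\mathsf{Var}$ and $q\in\mathbb{Q}^+$, such that $q>\mathrm{E}_{P,\eta}(v)$. **Theorem.** With respect to standard effective encodings of the tuples $(P,\eta,v,q)$, the set $\mathcal{REXP}$ is $\Sigma_2^0$-complete: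 there is a decidable relation $R$ such that $x\in\mathcal{REXP}\iff\exists y_1\,\forall y_2\ (x,y_1,y_2)\in R$, and every set $C$ of this form $\{x\mid\exists y_1\,\forall y_2\ (x,y_1,y_2)\in R'\}$, $R'$ decidable, is many-one reducible to $\mathcal{REXP}$ by a total computable function. In particular $\mathcal{REXP}$ is not recursively enumerable. -/

import Mathlib

open scoped NNReal ENNReal

namespace PGCL

/-! ### An effective numbering of the nonnegative rationals -/

/-- The rational with code `n`: code `0` is `0`, code `2 n + 1` is `x + 1` for the rational `x` with
code `n`, and code `2 n + 2` is `1 / (1 + y)` for the rational `y > 0` with code `n + 1`.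
Numerator and denominator are computed along the recursion in the obvious way. -/
def ratOfNat (n : ℕ) : ℚ≥0 :=
  if h : n = 0 then 0
  else if n % 2 = 1 then ratOfNat (n / 2) + 1
  else 1 / (1 + ratOfNat (n / 2))
termination_by n
decreasing_by all_goals omega

/-- The inverse numbering, on a fraction `a / b`. -/
def fracCode (a b : ℕ) : ℕ :=
  if h : a = 0 ∨ b = 0 then 0
  else if b ≤ a then 2 * fracCode (a - b) b + 1
  else 2 * fracCode (b - a) a
termination_by a + b
decreasing_by all_goals omega

def ratCode (q : ℚ≥0) : ℕ := fracCode q.num q.den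

theorem ratOfNat_pos {n : ℕ} (h : n ≠ 0) : 0 < ratOfNat n := by
  induction n using Nat.strong_induction_on with
  | _ n ih =>
    rw [ratOfNat, dif_neg h]
    split_ifs
    · exact add_pos_of_nonneg_of_pos zero_le one_pos
    · exact div_pos one_pos (add_pos_of_pos_of_nonneg one_pos zero_le)

theorem ratOfNat_fracCode (a b : ℕ) (hb : b ≠ 0) : ratOfNat (fracCode a b) = (a : ℚ≥0) / b := by
  induction hs : a + b using Nat.strong_induction_on generalizing a b with
  | _ s ih =>
    subst hs
    rw [fracCode]
    by_cases ha : a = 0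
    · simp [ha, ratOfNat]
    · rw [dif_neg (by tauto)]
      by_cases hba : b ≤ a
      · rw [if_pos hba, ratOfNat, dif_neg (by omega), if_pos (by omega),
          show (2 * fracCode (a - b) b + 1) / 2 = fracCode (a - b) b by omega,
          ih (a - b + b) (by omega) (a - b) b hb rfl]
        obtain ⟨c, rfl⟩ := Nat.exists_eq_add_of_le hba
        have : (b : ℚ≥0) ≠ 0 := by exact_mod_cast hb
        rw [Nat.add_sub_cancel_left]
        push_cast
        field_simp
        ring
      · rw [if_neg hba]
        obtain ⟨c, rfl⟩ := Nat.exists_eq_add_of_le (not_le.1 hba).le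
        rw [Nat.add_sub_cancel_left]
        have hc : c ≠ 0 := by omega
        have ih' := ih (c + a) (by omega) c a ha rfl
        have ha' : (a : ℚ≥0) ≠ 0 := by exact_mod_cast ha
        have hne : fracCode c a ≠ 0 := by
          intro h0
          rw [h0, ratOfNat, dif_pos rfl] at ih'
          have : (c : ℚ≥0) ≠ 0 := by exact_mod_cast hc
          exact (div_ne_zero this ha') ih'.symm
        rw [ratOfNat, dif_neg (by omega), if_neg (by omega),
          show 2 * fracCode c a / 2 = fracCode c a by omega, ih']
        push_cast
        have : (a : ℚ≥0) + c ≠ 0 := by positivity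
        field_simp

theorem ratOfNat_injective : Function.Injective ratOfNat := by
  have lt_one : ∀ x : ℚ≥0, 0 < x → 1 / (1 + x) < 1 := fun x hx => by
    rw [div_lt_one (by positivity)]
    exact lt_add_of_pos_right 1 hx
  have key : ∀ m, m ≠ 0 → (m % 2 = 1 → 1 ≤ ratOfNat m) ∧ (m % 2 ≠ 1 → ratOfNat m < 1) := by
    intro m hm
    constructor
    · intro h
      rw [ratOfNat, dif_neg hm, if_pos h]
      exact le_add_of_nonneg_left zero_le
    · intro h
      rw [ratOfNat, dif_neg hm, if_neg h]
      exact lt_one _ (ratOfNat_pos (by omega))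
  intro m n h
  induction m using Nat.strong_induction_on generalizing n with
  | _ m ih =>
    by_cases hm : m = 0
    · by_contra hn
      subst hm
      have := ratOfNat_pos (Ne.symm hn)
      rw [← h, ratOfNat, dif_pos rfl] at this
      exact lt_irrefl _ this
    by_cases hn : n = 0
    · subst hn
      have := ratOfNat_pos hm
      rw [h, ratOfNat, dif_pos rfl] at this
      exact absurd this (lt_irrefl _)
    by_cases pm : m % 2 = 1 <;> by_cases pn : n % 2 = 1
    · rw [ratOfNat, dif_neg hm, if_pos pm, ratOfNat.eq_def n, dif_neg hn, if_pos pn] at h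
      have := ih (m / 2) (by omega) (n := n / 2) (add_right_cancel h)
      omega
    · exact absurd (((key m hm).1 pm).trans_eq h) (not_le.2 ((key n hn).2 pn))
    · exact absurd (((key n hn).1 pn).trans_eq h.symm) (not_le.2 ((key m hm).2 pm))
    · rw [ratOfNat, dif_neg hm, if_neg pm, ratOfNat.eq_def n, dif_neg hn, if_neg pn] at h
      rw [one_div, one_div, inv_inj] at h
      have := ih (m / 2) (by omega) (n := n / 2) (add_left_cancel h)
      omega

theorem ratOfNat_ratCode (q : ℚ≥0) : ratOfNat (ratCode q) = q := by
  rw [ratCode, ratOfNat_fracCode _ _ q.den_ne_zero, NNRat.num_div_den]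

def ratEquiv : ℚ≥0 ≃ ℕ where
  toFun := ratCode
  invFun := ratOfNat
  left_inv := ratOfNat_ratCode
  right_inv n := ratOfNat_injective (ratOfNat_ratCode (ratOfNat n))

instance : Denumerable ℚ≥0 := Denumerable.mk' ratEquiv

/-! ### Syntax -/

/-- Rational probabilities. -/
abbrev Prob : Type := {p : ℚ≥0 // p ≤ 1}

/-- `p = 0` has code `0`; any other `p` has code `1 +` the code of `1 / p - 1`. -/
def probCode (p : Prob) : ℕ := if p.1 = 0 then 0 else ratCode (p.1⁻¹ - 1) + 1

def probOfNat : ℕ → Prob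
  | 0 => ⟨0, zero_le⟩
  | n + 1 => ⟨(1 + ratOfNat n)⁻¹, inv_le_one_of_one_le₀ (le_add_of_nonneg_right zero_le)⟩

theorem ratCode_ratOfNat (n : ℕ) : ratCode (ratOfNat n) = n := ratEquiv.right_inv n

def probEquiv : Prob ≃ ℕ where
  toFun := probCode
  invFun := probOfNat
  left_inv p := by
    obtain ⟨p, hp⟩ := p
    by_cases h : p = 0
    · subst h; rfl
    · have : 1 ≤ p⁻¹ := (one_le_inv₀ (pos_iff_ne_zero.2 h)).2 hp
      simp [probCode, h, probOfNat, ratOfNat_ratCode, add_tsub_cancel_of_le this]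
  right_inv n := by
    cases n with
    | zero => rfl
    | succ n =>
      have : (1 : ℚ≥0) + ratOfNat n ≠ 0 := (add_pos_of_pos_of_nonneg one_pos zero_le).ne'
      simp [probCode, probOfNat, this, ratCode_ratOfNat]

theorem probOfNat_probCode (p : Prob) : probOfNat (probCode p) = p := probEquiv.left_inv p
theorem probCode_probOfNat (n : ℕ) : probCode (probOfNat n) = n := probEquiv.right_inv n

instance : Denumerable Prob := Denumerable.mk' probEquiv

/-- Program variables. -/
abbrev Var : Type := ℕ

/-- Arithmetical expressions; negative constants are written `0 - c`. -/
inductive AExp : Type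
  | const (c : ℚ≥0)
  | var (x : Var)
  | add (e₁ e₂ : AExp)
  | sub (e₁ e₂ : AExp)
  | mul (e₁ e₂ : AExp)

/-- Boolean expressions over arithmetical expressions. -/
inductive BExp : Type
  | eq (e₁ e₂ : AExp)
  | lt (e₁ e₂ : AExp)
  | not (b : BExp)
  | and (b₁ b₂ : BExp)

/-- Probabilistic programs: assignment, sequential composition, probabilistic choice
`{P₁} [p] {P₂}` and while-loop. -/
inductive Prog : Type
  | assign (v : Var) (e : AExp)
  | seq (P₁ P₂ : Prog)
  | choice (p : Prob) (P₁ P₂ : Prog)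
  | loop (b : BExp) (P : Prog)

/-! ### Gödel numberings of the syntax -/

theorem unpair_fst_lt {n m : ℕ} (h : n < m) : n.unpair.1 < m := n.unpair_left_le.trans_lt h
theorem unpair_snd_lt {n m : ℕ} (h : n < m) : n.unpair.2 < m := n.unpair_right_le.trans_lt h

def AExp.code : AExp → ℕ
  | const c => 5 * ratCode c
  | var x => 5 * x + 1
  | add e₁ e₂ => 5 * Nat.pair e₁.code e₂.code + 2
  | sub e₁ e₂ => 5 * Nat.pair e₁.code e₂.code + 3
  | mul e₁ e₂ => 5 * Nat.pair e₁.code e₂.code + 4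

def AExp.ofCode (n : ℕ) : AExp :=
  if n % 5 = 0 then const (ratOfNat (n / 5))
  else if n % 5 = 1 then var (n / 5)
  else if n % 5 = 2 then add (ofCode (n / 5).unpair.1) (ofCode (n / 5).unpair.2)
  else if n % 5 = 3 then sub (ofCode (n / 5).unpair.1) (ofCode (n / 5).unpair.2)
  else mul (ofCode (n / 5).unpair.1) (ofCode (n / 5).unpair.2)
termination_by n
decreasing_by
  all_goals first
    | exact unpair_fst_lt (by omega)
    | exact unpair_snd_lt (by omega)

theorem AExp.ofCode_code (e : AExp) : ofCode e.code = e := by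
  induction e with
  | const c =>
    rw [code, ofCode, if_pos (by omega), show ∀ k, (5 * k) / 5 = k by omega, ratOfNat_ratCode]
  | var x =>
    rw [code, ofCode, if_neg (by omega), if_pos (by omega),
      show ∀ k, (5 * k + 1) / 5 = k by omega]
  | add e₁ e₂ h₁ h₂ =>
    rw [code, ofCode, if_neg (by omega), if_neg (by omega), if_pos (by omega)]
    rw [show ∀ k, (5 * k + 2) / 5 = k by omega]
    simp [h₁, h₂]
  | sub e₁ e₂ h₁ h₂ =>
    rw [code, ofCode, if_neg (by omega), if_neg (by omega), if_neg (by omega), if_pos (by omega)]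
    rw [show ∀ k, (5 * k + 3) / 5 = k by omega]
    simp [h₁, h₂]
  | mul e₁ e₂ h₁ h₂ =>
    rw [code, ofCode, if_neg (by omega), if_neg (by omega), if_neg (by omega), if_neg (by omega)]
    rw [show ∀ k, (5 * k + 4) / 5 = k by omega]
    simp [h₁, h₂]

theorem AExp.code_ofCode (n : ℕ) : (ofCode n).code = n := by
  induction n using Nat.strong_induction_on with
  | _ n ih =>
    rw [ofCode]
    split_ifs with h0 h1 h2 h3
    · simp only [code, ratCode_ratOfNat]; omega
    · simp only [code]; omega
    all_goals
      simp only [code]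
      rw [ih _ (unpair_fst_lt (by omega)), ih _ (unpair_snd_lt (by omega)), Nat.pair_unpair]
      omega

instance : Denumerable AExp :=
  Denumerable.mk' ⟨AExp.code, AExp.ofCode, AExp.ofCode_code, AExp.code_ofCode⟩

def BExp.code : BExp → ℕ
  | eq e₁ e₂ => 4 * Nat.pair e₁.code e₂.code
  | lt e₁ e₂ => 4 * Nat.pair e₁.code e₂.code + 1
  | not b => 4 * b.code + 2
  | and b₁ b₂ => 4 * Nat.pair b₁.code b₂.code + 3

def BExp.ofCode (n : ℕ) : BExp :=
  if n % 4 = 0 then eq (.ofCode (n / 4).unpair.1) (.ofCode (n / 4).unpair.2)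
  else if n % 4 = 1 then lt (.ofCode (n / 4).unpair.1) (.ofCode (n / 4).unpair.2)
  else if n % 4 = 2 then not (ofCode (n / 4))
  else and (ofCode (n / 4).unpair.1) (ofCode (n / 4).unpair.2)
termination_by n
decreasing_by
  all_goals first
    | exact unpair_fst_lt (by omega)
    | exact unpair_snd_lt (by omega)
    | omega

theorem BExp.ofCode_code (b : BExp) : ofCode b.code = b := by
  induction b with
  | eq e₁ e₂ =>
    rw [code, ofCode, if_pos (by omega)]
    rw [show ∀ k, (4 * k) / 4 = k by omega]
    simp [AExp.ofCode_code]
  | lt e₁ e₂ =>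
    rw [code, ofCode, if_neg (by omega), if_pos (by omega)]
    rw [show ∀ k, (4 * k + 1) / 4 = k by omega]
    simp [AExp.ofCode_code]
  | not b h =>
    rw [code, ofCode, if_neg (by omega), if_neg (by omega), if_pos (by omega)]
    rw [show ∀ k, (4 * k + 2) / 4 = k by omega, h]
  | and b₁ b₂ h₁ h₂ =>
    rw [code, ofCode, if_neg (by omega), if_neg (by omega), if_neg (by omega)]
    rw [show ∀ k, (4 * k + 3) / 4 = k by omega]
    simp [h₁, h₂]

theorem BExp.code_ofCode (n : ℕ) : (ofCode n).code = n := by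
  induction n using Nat.strong_induction_on with
  | _ n ih =>
    rw [ofCode]
    split_ifs with h0 h1 h2
    · simp only [code, AExp.code_ofCode, Nat.pair_unpair]; omega
    · simp only [code, AExp.code_ofCode, Nat.pair_unpair]; omega
    · simp only [code]; rw [ih _ (by omega)]; omega
    · simp only [code]
      rw [ih _ (unpair_fst_lt (by omega)), ih _ (unpair_snd_lt (by omega)), Nat.pair_unpair]
      omega

instance : Denumerable BExp :=
  Denumerable.mk' ⟨BExp.code, BExp.ofCode, BExp.ofCode_code, BExp.code_ofCode⟩

def Prog.code : Prog → ℕ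
  | assign v e => 4 * Nat.pair v e.code
  | seq P₁ P₂ => 4 * Nat.pair P₁.code P₂.code + 1
  | choice p P₁ P₂ => 4 * Nat.pair (probCode p) (Nat.pair P₁.code P₂.code) + 2
  | loop b P => 4 * Nat.pair b.code P.code + 3

def Prog.ofCode (n : ℕ) : Prog :=
  if n % 4 = 0 then assign (n / 4).unpair.1 (.ofCode (n / 4).unpair.2)
  else if n % 4 = 1 then seq (ofCode (n / 4).unpair.1) (ofCode (n / 4).unpair.2)
  else if n % 4 = 2 then choice (probOfNat (n / 4).unpair.1)
    (ofCode (n / 4).unpair.2.unpair.1) (ofCode (n / 4).unpair.2.unpair.2)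
  else loop (BExp.ofCode (n / 4).unpair.1) (ofCode (n / 4).unpair.2)
termination_by n
decreasing_by
  all_goals first
    | exact unpair_fst_lt (by omega)
    | exact unpair_snd_lt (by omega)
    | exact unpair_fst_lt (unpair_snd_lt (by omega))
    | exact unpair_snd_lt (unpair_snd_lt (by omega))

theorem Prog.ofCode_code (P : Prog) : ofCode P.code = P := by
  induction P with
  | assign v e =>
    rw [code, ofCode, if_pos (by omega)]
    rw [show ∀ k, (4 * k) / 4 = k by omega]
    simp [AExp.ofCode_code]
  | seq P₁ P₂ h₁ h₂ =>
    rw [code, ofCode, if_neg (by omega), if_pos (by omega)]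
    rw [show ∀ k, (4 * k + 1) / 4 = k by omega]
    simp [h₁, h₂]
  | choice p P₁ P₂ h₁ h₂ =>
    rw [code, ofCode, if_neg (by omega), if_neg (by omega), if_pos (by omega)]
    rw [show ∀ k, (4 * k + 2) / 4 = k by omega]
    simp only [Nat.unpair_pair, probOfNat_probCode, h₁, h₂]
  | loop b P h =>
    rw [code, ofCode, if_neg (by omega), if_neg (by omega), if_neg (by omega)]
    rw [show ∀ k, (4 * k + 3) / 4 = k by omega]
    simp only [Nat.unpair_pair, BExp.ofCode_code, h]

theorem Prog.code_ofCode (n : ℕ) : (ofCode n).code = n := by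
  induction n using Nat.strong_induction_on with
  | _ n ih =>
    rw [ofCode]
    split_ifs with h0 h1 h2
    · simp only [code, AExp.code_ofCode, Nat.pair_unpair]; omega
    · simp only [code]
      rw [ih _ (unpair_fst_lt (by omega)), ih _ (unpair_snd_lt (by omega)), Nat.pair_unpair]
      omega
    · simp only [code]
      rw [ih _ (unpair_fst_lt (unpair_snd_lt (by omega))),
        ih _ (unpair_snd_lt (unpair_snd_lt (by omega))), probCode_probOfNat, Nat.pair_unpair,
        Nat.pair_unpair]
      omega
    · simp only [code]
      rw [ih _ (unpair_snd_lt (by omega)), BExp.code_ofCode, Nat.pair_unpair]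
      omega

instance : Denumerable Prog :=
  Denumerable.mk' ⟨Prog.code, Prog.ofCode, Prog.ofCode_code, Prog.code_ofCode⟩

/-! ### Valuations -/

/-- Variable valuations. Being inputs of algorithms they are finite objects: all but finitely many
variables have value `0`. -/
abbrev Val : Type := Var →₀ ℚ≥0

theorem ratCode_zero : ratCode 0 = 0 := by
  rw [ratCode, fracCode]
  simp

/-- A valuation is coded as the multiset of variables that contains each variable `x` exactly
`ratCode (η x)` times. -/
noncomputable def valEquiv : Val ≃ Multiset ℕ :=
  (Finsupp.mapRange.equiv ratEquiv ratCode_zero).trans Multiset.toFinsupp.symm.toEquiv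

noncomputable instance : Denumerable Val := Denumerable.ofEquiv (Multiset ℕ) valEquiv

/-! ### Semantics -/

/-- The value of an arithmetical expression (possibly negative). -/
def AExp.eval (η : Val) : AExp → ℚ
  | const c => (c : ℚ)
  | var x => (η x : ℚ)
  | add e₁ e₂ => e₁.eval η + e₂.eval η
  | sub e₁ e₂ => e₁.eval η - e₂.eval η
  | mul e₁ e₂ => e₁.eval η * e₂.eval η

def BExp.eval (η : Val) : BExp → Bool
  | eq e₁ e₂ => decide (e₁.eval η = e₂.eval η)
  | lt e₁ e₂ => decide (e₁.eval η < e₂.eval η)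
  | not b => !b.eval η
  | and b₁ b₂ => b₁.eval η && b₂.eval η

/-- The way a probabilistic choice is resolved. -/
inductive Dir : Type
  | L
  | R

instance : Fintype Dir := ⟨⟨[Dir.L, Dir.R], by simp⟩, fun d => by cases d <;> simp⟩

/-- What is left to be executed: nothing (`↓`), a program, or a remainder followed by a program
(so that `↓; P` can be written). -/
inductive Ctl : Type
  | done
  | prog (P : Prog)
  | seq (c : Ctl) (P : Prog)

/-- Program states: what is left to be executed, the current valuation, the probability of the
choices made so far, and the record of these choices. -/
structure State : Type where
  ctl : Ctl
  val : Val
  prob : ℚ≥0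
  trace : List Dir

/-- The rule (concat1): a step of a component is a step of the composition with `P₂`. -/
def State.andThen (P₂ : Prog) (σ : State) : State := { σ with ctl := Ctl.seq σ.ctl P₂ }

/-- The one-step successors of `⟨P, η, a, θ⟩` for a program `P`. The label is `none` for a step
that makes no probabilistic choice and `some d` for a choice that is resolved as `d`; the result is
`none` if there is no step with that label. -/
noncomputable def Prog.step (η : Val) (a : ℚ≥0) (θ : List Dir) : Prog → Option Dir → Option State
  | assign v e, none => some ⟨Ctl.done, η.update v (max (e.eval η) 0).toNNRat, a, θ⟩
  | assign _ _, some _ => none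
  | seq P₁ P₂, d => (P₁.step η a θ d).map (State.andThen P₂)
  | choice _ _ _, none => none
  | choice p P₁ _, some Dir.L => some ⟨Ctl.prog P₁, η, a * p.1, θ ++ [Dir.L]⟩
  | choice p _ P₂, some Dir.R => some ⟨Ctl.prog P₂, η, a * (1 - p.1), θ ++ [Dir.R]⟩
  | loop b P, none =>
      if b.eval η then some ⟨Ctl.seq (Ctl.prog P) (loop b P), η, a, θ⟩
      else some ⟨Ctl.done, η, a, θ⟩
  | loop _ _, some _ => none

/-- The one-step successors of an arbitrary remainder. -/
noncomputable def Ctl.step (η : Val) (a : ℚ≥0) (θ : List Dir) : Ctl → Option Dir → Option State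
  | done, _ => none
  | prog P, d => P.step η a θ d
  | seq done P₂, none => some ⟨prog P₂, η, a, θ⟩
  | seq done _, some _ => none
  | seq (prog P) P₂, d => (P.step η a θ d).map (State.andThen P₂)
  | seq (seq c P) P₂, d => ((seq c P).step η a θ d).map (State.andThen P₂)

noncomputable def State.step (σ : State) (d : Option Dir) : Option State :=
  σ.ctl.step σ.val σ.prob σ.trace d

/-- The state reached from `σ` after exactly `k` steps in which exactly `w.length` probabilistic
choices are made and these are resolved according to `w`; `none` stands for `⊥`. -/
noncomputable def stateSucc : ℕ → State → List Dir → Option State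
  | 0, σ, [] => some σ
  | 0, _, _ :: _ => none
  | k + 1, σ, w =>
      match σ.step none, w with
      | some τ, w => stateSucc k τ w
      | none, [] => none
      | none, d :: w' => (σ.step (some d)).bind fun τ => stateSucc k τ w'

/-- The probability of a terminal state times the value of `v` in it; `0` if not terminal. -/
def weight (v : Var) : Option State → ℚ≥0
  | some ⟨Ctl.done, η, a, _⟩ => η v * a
  | _ => 0

def initState (P : Prog) (η : Val) : State := ⟨Ctl.prog P, η, 1, []⟩

/-- The expected outcome of `v` after executing `P` on `η`: the sum over all step counts `k` and
all words `w` over `{L, R}` of length `j ≤ k`. -/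
noncomputable def expectedOutcome (P : Prog) (η : Val) (v : Var) : ℝ≥0∞ :=
  ∑' k : ℕ, ∑ j ∈ Finset.range (k + 1), ∑ w : Fin j → Dir,
    ((weight v (stateSucc k (initState P η) (List.ofFn w)) : ℝ≥0) : ℝ≥0∞)

/-- The set of all `(P, η, v, q)` such that `q` exceeds the expected outcome. -/
def REXP : Set (Prog × Val × Var × ℚ≥0) :=
  {x | expectedOutcome x.1 x.2.1 x.2.2.1 < ((x.2.2.2 : ℝ≥0) : ℝ≥0∞)}

/-! ### The class `Σ₂⁰` -/

/-- `A = {x | ∃ y₁, ∀ y₂, R x y₁ y₂}` for a decidable relation `R`. -/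
def IsSigma2 {α : Type} [Primcodable α] (A : Set α) : Prop :=
  ∃ R : α → ℕ → ℕ → Prop, ComputablePred (fun t : α × ℕ × ℕ => R t.1 t.2.1 t.2.2) ∧
    ∀ x, x ∈ A ↔ ∃ y₁, ∀ y₂, R x y₁ y₂

/-- Every `Σ₂⁰` set is many-one reducible to `A`. -/
def IsSigma2Hard {α : Type} [Primcodable α] (A : Set α) : Prop :=
  ∀ (β : Type) [Primcodable β] (C : Set β), IsSigma2 C →
    ManyOneReducible (fun y => y ∈ C) (fun x => x ∈ A)

def IsSigma2Complete {α : Type} [Primcodable α] (A : Set α) : Prop :=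
  IsSigma2 A ∧ IsSigma2Hard A

end PGCL

namespace PGCL

/-! ### The expected outcome of a state -/

/-! Membership in `Σ₂⁰`. The expected outcome is the supremum of its partial sums over the runs of
length less than `N`. Hence it is below `q` iff some rational `r < q` bounds all partial sums
(`expectedOutcome_lt_iff`), which is an `∃∀` statement over a decidable matrix once the partial sums
are computable. For this the operational semantics is simulated by a machine on codes whose
configurations consist of a head, a stack of programs still to be run, an association list and a
probability; its step is primitive recursive (`Config.primrec_succ`) and it yields the same sums
(`Represents.mass_eq`).

Hardness. A `Σ₂⁰` set can be written as `∃ y, ∀ z, g (x, y, z) ≠ 0` with `g` primitive recursive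
(`IsSigma2.exists_primrec`), and every such `g` is computed by a program without probabilistic
choice (`computes_of_primrec`). For a given `x` the reduction produces a program that starts with `y
= 0` and repeats: search for `z` with `g (x, y, z) = 0`; if one is found, increment `y` and toss a
fair coin that decides between stopping with output `1` and continuing. If every `y` has a zero, the
output is `1` with probability one and the outcome is `1`. If `y` is the least value without a zero,
the program diverges with probability `2 ^ (-y)`, and the outcome is `1 - 2 ^ (-y) < 1`. So `x`
belongs to the set iff the outcome is below the threshold `1` (`expectedOutcome_mainLoop_lt_iff`).

Non-enumerability. Non-halting is `Σ₂⁰`, so it reduces to any `Σ₂⁰`-hard set, but it is not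
recursively enumerable (`not_rePred_of_isSigma2Hard`). -/

/-- The contribution of the runs of length `k` from `σ` to the expected outcome of `v`. -/
noncomputable def mass (v : Var) (k : ℕ) (σ : State) : ℚ≥0 :=
  ∑ j ∈ Finset.range (k + 1), ∑ w : Fin j → Dir, weight v (stateSucc k σ (List.ofFn w))

/-- The expected outcome of `v` from the state `σ`. -/
noncomputable def outcome (v : Var) (σ : State) : ℝ≥0∞ :=
  ∑' k : ℕ, ((mass v k σ : ℝ≥0) : ℝ≥0∞)

theorem expectedOutcome_eq (P : Prog) (η : Val) (v : Var) :
    expectedOutcome P η v = outcome v (initState P η) := by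
  simp only [expectedOutcome, outcome, mass]
  refine tsum_congr fun k => ?_
  push_cast
  rfl

/-- Each letter of the word costs one step. -/
theorem stateSucc_eq_none {k : ℕ} {σ : State} {w : List Dir} (h : k < w.length) :
    stateSucc k σ w = none := by
  induction k generalizing σ w with
  | zero => cases w with
    | nil => simp at h
    | cons d w => rfl
  | succ k ih =>
    cases hs : σ.step none with
    | some τ =>
      simp only [stateSucc, hs]
      exact ih (by omega)
    | none => cases w with
      | nil => simp at h
      | cons d w =>
        simp only [stateSucc, hs]
        cases σ.step (some d) with
        | none => rfl
        | some τ => exact ih (by simpa using h)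

theorem sum_ofFn_succ (j : ℕ) (F : List Dir → ℚ≥0) :
    ∑ w : Fin (j + 1) → Dir, F (List.ofFn w) =
      ∑ w : Fin j → Dir, F (Dir.L :: List.ofFn w) + ∑ w : Fin j → Dir, F (Dir.R :: List.ofFn w) := by
  have hd : ∀ G : Dir → ℚ≥0, ∑ d, G d = G Dir.L + G Dir.R := fun G => by
    simp [Finset.sum, Finset.univ, Fintype.elems]
  rw [← hd fun d => ∑ w : Fin j → Dir, F (d :: List.ofFn w), ← Fintype.sum_prod_type',
    ← (Fin.consEquiv fun _ : Fin (j + 1) => Dir).sum_comp]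
  simp [Fin.consEquiv, List.ofFn_succ]

theorem mass_zero (v : Var) (σ : State) : mass v 0 σ = weight v (some σ) := by
  simp [mass, stateSucc]

/-- A deterministic step reads no letter, so both sides range over the same words, except for those
of length `k + 1`, which are too long for `k` steps from `τ`. -/
theorem mass_succ_of_step {σ τ : State} (h : σ.step none = some τ) (v : Var) (k : ℕ) :
    mass v (k + 1) σ = mass v k τ := by
  have hs : ∀ w, stateSucc (k + 1) σ w = stateSucc k τ w := fun w => by simp only [stateSucc, h]
  rw [mass, Finset.sum_range_succ, mass]
  simp only [hs]
  rw [add_eq_left]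
  exact Finset.sum_eq_zero fun w _ => by rw [stateSucc_eq_none (by simp)]; rfl

/-- Without a deterministic step the first letter is consumed, so the words split according to it. A
missing successor counts as `0`, which also covers terminal states. -/
theorem mass_succ_of_step_none {σ : State} (h : σ.step none = none) (v : Var) (k : ℕ) :
    mass v (k + 1) σ = ((σ.step (some Dir.L)).map (mass v k)).getD 0 +
      ((σ.step (some Dir.R)).map (mass v k)).getD 0 := by
  rw [mass, Finset.sum_range_succ']
  simp only [fun j => sum_ofFn_succ j fun w => weight v (stateSucc (k + 1) σ w),
    Finset.sum_add_distrib]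
  have hd : ∀ d, ∑ j ∈ Finset.range (k + 1), ∑ w : Fin j → Dir,
      weight v (stateSucc (k + 1) σ (d :: List.ofFn w)) =
        ((σ.step (some d)).map (mass v k)).getD 0 := fun d => by
    simp only [stateSucc, h]
    cases σ.step (some d) with
    | none => exact Finset.sum_eq_zero fun _ _ => Finset.sum_eq_zero fun _ _ => rfl
    | some τ => rfl
  rw [hd, hd, add_eq_left]
  exact Finset.sum_eq_zero fun w _ => by simp [stateSucc, h, weight]

theorem weight_eq_zero {σ : State} (h : σ.ctl ≠ Ctl.done) (v : Var) : weight v (some σ) = 0 := by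
  obtain ⟨c, η, a, θ⟩ := σ
  cases c <;> first | rfl | exact absurd rfl h

theorem outcome_eq_add (v : Var) (σ : State) :
    outcome v σ = ((weight v (some σ) : ℝ≥0) : ℝ≥0∞) +
      ∑' k : ℕ, ((mass v (k + 1) σ : ℝ≥0) : ℝ≥0∞) := by
  rw [outcome, tsum_eq_zero_add' ENNReal.summable, mass_zero]

theorem ctl_ne_done_of_step {σ τ : State} {d : Option Dir} (h : σ.step d = some τ) :
    σ.ctl ≠ Ctl.done := by
  intro h0
  simp [State.step, h0, Ctl.step] at h

/-- The step shifts the series by one index; the lost term at index `0` vanishes because a state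
with a successor is not terminal. -/
theorem outcome_of_step {σ τ : State} (h : σ.step none = some τ) (v : Var) :
    outcome v σ = outcome v τ := by
  rw [outcome_eq_add, weight_eq_zero (ctl_ne_done_of_step h)]
  simp only [mass_succ_of_step h]
  simp [outcome]

theorem outcome_of_choice {σ τ₁ τ₂ : State} (h : σ.step none = none)
    (h₁ : σ.step (some Dir.L) = some τ₁) (h₂ : σ.step (some Dir.R) = some τ₂) (v : Var) :
    outcome v σ = outcome v τ₁ + outcome v τ₂ := by
  rw [outcome_eq_add, weight_eq_zero (ctl_ne_done_of_step h₁)]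
  simp only [mass_succ_of_step_none h, h₁, h₂, Option.map_some, Option.getD_some]
  simp [outcome, ENNReal.tsum_add]

theorem outcome_done (v : Var) (η : Val) (a : ℚ≥0) (θ : List Dir) :
    outcome v ⟨Ctl.done, η, a, θ⟩ = (((η v * a : ℚ≥0) : ℝ≥0) : ℝ≥0∞) := by
  rw [outcome_eq_add]
  have h : ∀ d, State.step ⟨Ctl.done, η, a, θ⟩ d = none := fun d => rfl
  simp [mass_succ_of_step_none (h none), h, weight]

/-! ### Deterministic runs -/

def Steps : State → State → Prop :=
  Relation.ReflTransGen fun σ τ => σ.step none = some τ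

theorem Steps.trans {σ τ ρ : State} (h : Steps σ τ) (h' : Steps τ ρ) : Steps σ ρ :=
  Relation.ReflTransGen.trans h h'

theorem Steps.outcome_eq {σ τ : State} (h : Steps σ τ) (v : Var) :
    outcome v σ = outcome v τ := by
  induction h with
  | refl => rfl
  | tail _ h ih => rw [ih, outcome_of_step h]

/-- The state `↓; P` must be excluded: it steps to `P` although `↓` has no step. -/
theorem step_andThen {σ : State} (h : σ.ctl ≠ Ctl.done) (P : Prog) (d : Option Dir) :
    (σ.andThen P).step d = (σ.step d).map (State.andThen P) := by
  obtain ⟨c, η, a, θ⟩ := σ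
  cases c with
  | done => exact absurd rfl h
  | prog Q => rfl
  | seq c Q => rfl

theorem step_andThen_of_step {σ τ : State} {d : Option Dir} (h : σ.step d = some τ) (P : Prog) :
    (σ.andThen P).step d = some (τ.andThen P) := by
  rw [step_andThen (ctl_ne_done_of_step h), h]; rfl

theorem Steps.andThen {σ τ : State} (h : Steps σ τ) (P : Prog) :
    Steps (σ.andThen P) (τ.andThen P) := by
  induction h with
  | refl => exact .refl
  | tail _ h ih => exact ih.tail (step_andThen_of_step h P)

/-- If every state of a set reaches the set again by a nonempty deterministic run, then the
states of the set have outcome zero. -/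
theorem outcome_eq_zero {S : Set State}
    (hS : ∀ σ ∈ S, ∃ ρ ∈ S, Relation.TransGen (fun σ τ : State => σ.step none = some τ) σ ρ)
    (v : Var) {σ : State} (hσ : σ ∈ S) : outcome v σ = 0 := by
  -- The induction on the length needs all states on the way to `S`, since the successor of a state
  -- of `S` may lie outside `S`.
  have key : ∀ k σ ρ, Steps σ ρ → ρ ∈ S → mass v k σ = 0 := by
    intro k
    induction k with
    | zero =>
      intro σ ρ h hρ
      rw [mass_zero]
      apply weight_eq_zero
      rcases h.cases_head with rfl | ⟨τ, h, _⟩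
      · obtain ⟨_, _, hT⟩ := hS _ hρ
        obtain ⟨_, h, _⟩ := Relation.TransGen.head'_iff.1 hT
        exact ctl_ne_done_of_step h
      · exact ctl_ne_done_of_step h
    | succ k ih =>
      intro σ ρ h hρ
      rcases h.cases_head with rfl | ⟨τ, h, hτ⟩
      · obtain ⟨ρ, hρ, hT⟩ := hS _ hρ
        obtain ⟨τ, h, hτ⟩ := Relation.TransGen.head'_iff.1 hT
        rw [mass_succ_of_step h]
        exact ih _ _ hτ hρ
      · rw [mass_succ_of_step h]
        exact ih _ _ hτ hρ
  simp [outcome, key _ σ σ .refl hσ]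

/-- `P` runs deterministically from the valuation `η` to the valuation `η'`. -/
def Runs (P : Prog) (η η' : Val) : Prop :=
  ∀ a θ, Steps ⟨Ctl.prog P, η, a, θ⟩ ⟨Ctl.done, η', a, θ⟩

theorem Runs.assign {η : Val} {x : Var} {e : AExp} {n : ℕ} (h : e.eval η = n) :
    Runs (.assign x e) η (η.update x n) := fun a θ => by
  refine .single ?_
  simp [State.step, Ctl.step, Prog.step, h]

/-- Assignments cut negative values off at `0`, which on natural numbers is truncated subtraction.
This is the source of all case distinctions in `condProg`. -/
theorem Runs.assign_sub {η : Val} {x : Var} {e : AExp} {m n : ℕ} (h : e.eval η = m - n) :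
    Runs (.assign x e) η (η.update x (m - n : ℕ)) := fun a θ => by
  refine .single ?_
  have : (max ((m : ℚ) - n) 0).toNNRat = (m - n : ℕ) := by
    rcases le_total n m with h | h
    · rw [max_eq_left (by simpa using h), ← Nat.cast_sub h]; simp
    · rw [max_eq_right (by simpa using h), Nat.sub_eq_zero_of_le h]; simp
  simp [State.step, Ctl.step, Prog.step, h, this]

/-- Running `P` inside a sequential composition. -/
theorem Runs.steps_seq {P Q : Prog} {η η' : Val} (h : Runs P η η') (a : ℚ≥0) (θ : List Dir) :
    Steps ⟨Ctl.seq (Ctl.prog P) Q, η, a, θ⟩ ⟨Ctl.prog Q, η', a, θ⟩ :=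
  ((h a θ).andThen Q).tail rfl

/-- The program `P; Q` and the remainder `P` followed by `Q` are different states with the same
successors, so the runs from them differ only in their first state. -/
theorem Runs.steps_prog_seq {P Q : Prog} {η η' : Val} (h : Runs P η η') (a : ℚ≥0)
    (θ : List Dir) : Steps ⟨Ctl.prog (.seq P Q), η, a, θ⟩ ⟨Ctl.prog Q, η', a, θ⟩ := by
  rcases (h.steps_seq (Q := Q) a θ).cases_head with h | ⟨τ, h, hτ⟩
  · simp at h
  · exact .head h hτ

theorem Runs.seq {P Q : Prog} {η η' η'' : Val} (h : Runs P η η') (h' : Runs Q η' η'') :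
    Runs (.seq P Q) η η'' := fun a θ =>
  (h.steps_prog_seq a θ).trans (h' a θ)

theorem step_loop_true {b : BExp} {η : Val} (h : b.eval η = true) (P : Prog) (a : ℚ≥0)
    (θ : List Dir) : State.step ⟨Ctl.prog (.loop b P), η, a, θ⟩ none =
      some ⟨Ctl.seq (Ctl.prog P) (.loop b P), η, a, θ⟩ := by
  simp [State.step, Ctl.step, Prog.step, h]

theorem step_loop_false {b : BExp} {η : Val} (h : b.eval η = false) (P : Prog) (a : ℚ≥0)
    (θ : List Dir) : State.step ⟨Ctl.prog (.loop b P), η, a, θ⟩ none =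
      some ⟨Ctl.done, η, a, θ⟩ := by
  simp [State.step, Ctl.step, Prog.step, h]

theorem Runs.loop_false {b : BExp} {η : Val} (h : b.eval η = false) (P : Prog) :
    Runs (.loop b P) η η := fun a θ => .single (step_loop_false h P a θ)

theorem Runs.loop_true {b : BExp} {P : Prog} {η η' η'' : Val} (h : b.eval η = true)
    (hP : Runs P η η') (h' : Runs (.loop b P) η' η'') : Runs (.loop b P) η η'' := fun a θ =>
  .head (step_loop_true h P a θ) ((hP.steps_seq a θ).trans (h' a θ))

/-! ### Programs for primitive recursive functions -/

/-- `P` runs deterministically from `η` to a valuation that satisfies `Q`. -/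
def Ends (P : Prog) (η : Val) (Q : Val → Prop) : Prop := ∃ η', Runs P η η' ∧ Q η'

theorem Ends.seq {P P' : Prog} {η : Val} {Q Q' : Val → Prop} (h : Ends P η Q)
    (h' : ∀ η', Q η' → Ends P' η' Q') : Ends (.seq P P') η Q' := by
  obtain ⟨η₁, h₁, hQ⟩ := h
  obtain ⟨η₂, h₂, hQ'⟩ := h' η₁ hQ
  exact ⟨η₂, h₁.seq h₂, hQ'⟩

theorem Ends.mono {P : Prog} {η : Val} {Q Q' : Val → Prop} (h : Ends P η Q)
    (h' : ∀ η', Q η' → Q' η') : Ends P η Q' :=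
  let ⟨η₁, h₁, hQ⟩ := h
  ⟨η₁, h₁, h' _ hQ⟩

/-- The invariant `I` is indexed by the number of completed iterations, and `m` is the index at
which the guard first fails. -/
theorem Ends.loop {b : BExp} {P : Prog} {I : ℕ → Val → Prop} {m : ℕ}
    (ht : ∀ k < m, ∀ η, I k η → b.eval η = true ∧ Ends P η (I (k + 1)))
    (hf : ∀ η, I m η → b.eval η = false) {η : Val} {k : ℕ} (hk : k ≤ m) (h : I k η) :
    Ends (.loop b P) η (I m) := by
  induction hk using Nat.decreasingInduction generalizing η with
  | self => exact ⟨η, .loop_false (hf η h) P, h⟩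
  | of_succ k hk ih =>
    obtain ⟨hb, η₁, h₁, hI⟩ := ht k hk η h
    obtain ⟨η₂, h₂, hI'⟩ := ih hI
    exact ⟨η₂, .loop_true hb h₁ h₂, hI'⟩

/-! ### Building blocks: conditional assignment, pairing, square root, unpairing -/

/-- `η'` has the value `n` at `o` and agrees with `η` at the other variables below `s`. -/
def Sets (s : ℕ) (η : Val) (o : ℕ) (n : ℕ) (η' : Val) : Prop :=
  η' o = n ∧ ∀ x < s, x ≠ o → η' x = η x

theorem sets_update (s : ℕ) (η : Val) (o : ℕ) (n : ℕ) : Sets s η o n (η.update o n) := by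
  refine ⟨by simp, fun x _ hx => by simp [hx]⟩

theorem ends_assign {η : Val} {e : AExp} {n : ℕ} (h : e.eval η = n) (s : ℕ) (o : ℕ) :
    Ends (.assign o e) η (Sets s η o n) := ⟨_, .assign h, sets_update ..⟩

theorem ends_assign_sub {η : Val} {e : AExp} {m n : ℕ} (h : e.eval η = m - n) (s : ℕ) (o : ℕ) :
    Ends (.assign o e) η (Sets s η o (m - n)) := ⟨_, .assign_sub h, sets_update ..⟩

/-- The assignment `o := if a < b then e₁ else e₂`, using the variable `s`. -/
def condProg (a b e₁ e₂ : AExp) (o s : ℕ) : Prog :=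
  .seq (.assign s (.sub b a)) (.seq (.assign s (.sub (.const 1) (.var s)))
    (.assign o (.add (.mul (.var s) e₂) (.mul (.sub (.const 1) (.var s)) e₁))))

/-- The expression mentions only variables below `s`. -/
def AExp.Below (s : ℕ) (e : AExp) : Prop :=
  ∀ η η' : Val, (∀ x < s, η x = η' x) → e.eval η = e.eval η'

/-- The two assignments to `s` compute `1 ∸ (b ∸ a)`, which is `0` if `a < b` and `1` otherwise, and
the last one selects by multiplication. The selected expressions are evaluated after `s` has been
overwritten, so they must not depend on it. -/
theorem ends_condProg {a b e₁ e₂ : AExp} {o s : ℕ} (h₁ : e₁.Below s) (h₂ : e₂.Below s) {η : Val} {m n k : ℕ}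
    (hm : a.eval η = m) (hn : b.eval η = n)
    (hk : (if m < n then e₁ else e₂).eval η = k) :
    Ends (condProg a b e₁ e₂ o s) η (Sets s η o k) := by
  refine (ends_assign_sub (m := n) (n := m) (by simp [AExp.eval, hm, hn]) (s + 1) s).seq
    fun η₁ s₁ => ?_
  refine (ends_assign_sub (m := 1) (n := n - m)
    (by simp only [AExp.eval, s₁.1, NNRat.cast_natCast, NNRat.cast_one, Nat.cast_one]) (s + 1) s).seq
    fun η₂ s₂ => ?_
  have hη : ∀ x < s, η₂ x = η x := fun x hx => by
    rw [s₂.2 x (by omega) (by omega), s₁.2 x (by omega) (by omega)]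
  refine (ends_assign (n := k) ?_ s o).mono fun η₃ s₃ =>
    ⟨s₃.1, fun x hx ho => (s₃.2 x hx ho).trans (hη x hx)⟩
  simp only [AExp.eval, s₂.1, h₁ _ _ hη, h₂ _ _ hη]
  split_ifs at hk with h
  · simp [hk, show 1 - (n - m) = 0 by omega]
  · simp [hk, show n - m = 0 by omega]

theorem AExp.below_var {x s : ℕ} (h : x < s) : (AExp.var x).Below s := fun η η' H => by
  simp [AExp.eval, H x h]

theorem AExp.Below.add {e₁ e₂ : AExp} {s : ℕ} (h₁ : e₁.Below s) (h₂ : e₂.Below s) :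
    (AExp.add e₁ e₂).Below s := fun η η' H => by simp [AExp.eval, h₁ _ _ H, h₂ _ _ H]

theorem AExp.Below.sub {e₁ e₂ : AExp} {s : ℕ} (h₁ : e₁.Below s) (h₂ : e₂.Below s) :
    (AExp.sub e₁ e₂).Below s := fun η η' H => by simp [AExp.eval, h₁ _ _ H, h₂ _ _ H]

theorem AExp.Below.mul {e₁ e₂ : AExp} {s : ℕ} (h₁ : e₁.Below s) (h₂ : e₂.Below s) :
    (AExp.mul e₁ e₂).Below s := fun η η' H => by simp [AExp.eval, h₁ _ _ H, h₂ _ _ H]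

/-- The assignment of `Nat.pair a b` to `o`, using the variable `s`. -/
def pairProg (a b o s : ℕ) : Prog :=
  condProg (.var a) (.var b) (.add (.mul (.var b) (.var b)) (.var a))
    (.add (.add (.mul (.var a) (.var a)) (.var a)) (.var b)) o s

/-- The target `o` may coincide with `a` or `b`, because it is written only by the last assignment;
`Computes.prec` and `tripleProg` rely on this. -/
theorem ends_pairProg {a b o s : ℕ} (ha : a < s) (hb : b < s) {η : Val} {m n : ℕ}
    (hm : η a = m) (hn : η b = n) : Ends (pairProg a b o s) η (Sets s η o (Nat.pair m n)) := by
  have ha' := AExp.below_var ha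
  have hb' := AExp.below_var hb
  refine ends_condProg ((hb'.mul hb').add ha') (((ha'.mul ha').add ha').add hb')
    (m := m) (n := n) (by simp [AExp.eval, hm]) (by simp [AExp.eval, hn]) ?_
  rw [Nat.pair]
  split_ifs <;> simp [AExp.eval, hm, hn]

/-- Stores the square root of `i` in `s`. -/
def sqrtProg (i s : ℕ) : Prog :=
  .seq (.assign s (.const 0)) (.loop (.not (.lt (.var i) (.mul (.add (.var s) (.const 1))
    (.add (.var s) (.const 1))))) (.assign s (.add (.var s) (.const 1))))

theorem ends_sqrtProg {i s t : ℕ} (hi : i < s) (ht : i < t) {η : Val} {n : ℕ} (hn : η i = n) :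
    Ends (sqrtProg i s) η (Sets t η s n.sqrt) := by
  refine (ends_assign (n := 0) (by simp [AExp.eval]) t s).seq fun η₁ s₁ => ?_
  -- A linear search whose number of iterations is exactly `n.sqrt`.
  refine Ends.loop (I := fun k η' => Sets t η s k η') (fun k hk η' h => ?_) (fun η' h => ?_)
    (Nat.zero_le _) s₁
  · have hi' : η' i = n := by rw [h.2 i ht (by omega), hn]
    constructor
    · have : (k + 1) * (k + 1) ≤ n := Nat.le_sqrt.1 hk
      have : ((k : ℚ) + 1) * (k + 1) ≤ n := by exact_mod_cast this
      simpa [BExp.eval, AExp.eval, hi', h.1] using this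
    · refine (ends_assign (n := k + 1) (by simp [AExp.eval, h.1]) t s).mono fun η'' h'' => ?_
      exact ⟨h''.1, fun x hx hs => (h''.2 x hx hs).trans (h.2 x hx hs)⟩
  · have hi' : η' i = n := by rw [h.2 i ht (by omega), hn]
    have : n < (n.sqrt + 1) * (n.sqrt + 1) := Nat.lt_succ_sqrt n
    have : (n : ℚ) < ((n.sqrt : ℚ) + 1) * (n.sqrt + 1) := by exact_mod_cast this
    simpa [BExp.eval, AExp.eval, hi', h.1] using this

/-- `f` is computed by programs: for any variables `i` and `o` below `s` there is a program that
stores the value of `f` at `i` in `o` and leaves the other variables below `s` alone. -/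
def Computes (f : ℕ → ℕ) : Prop :=
  ∀ i o s : ℕ, i < s → o < s → ∃ P, ∀ (η : Val) (n : ℕ), η i = n → Ends P η (Sets s η o (f n))

/-- Both components of `Nat.unpair` are case distinctions on whether the remainder `n - n.sqrt ^ 2`
is below the root, with branches that are expressions in root and remainder. The root is kept in `s`
and the remainder in `s + 1`. -/
theorem computes_unpair (c₁ c₂ : ℕ → ℕ → ℕ) (e₁ e₂ : ℕ → ℕ → AExp)
    (hb : ∀ t r s, t < s → r < s → (e₁ t r).Below s ∧ (e₂ t r).Below s)
    (h₁ : ∀ (η : Val) t r k l, η t = (k : ℕ) → η r = (l : ℕ) → l < k →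
      (e₁ t r).eval η = c₁ k l)
    (h₂ : ∀ (η : Val) t r k l, η t = (k : ℕ) → η r = (l : ℕ) → k ≤ l →
      (e₂ t r).eval η = c₂ k l) :
    Computes fun n => if n - n.sqrt * n.sqrt < n.sqrt then c₁ n.sqrt (n - n.sqrt * n.sqrt)
      else c₂ n.sqrt (n - n.sqrt * n.sqrt) := by
  intro i o s hi ho
  refine ⟨.seq (sqrtProg i s) (.seq (.assign (s + 1) (.sub (.var i) (.mul (.var s) (.var s))))
    (condProg (.var (s + 1)) (.var s) (e₁ s (s + 1)) (e₂ s (s + 1)) o (s + 2))), ?_⟩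
  intro η n hn
  refine (ends_sqrtProg (t := s + 2) hi (by omega) hn).seq fun η₁ s₁ => ?_
  have hi₁ : η₁ i = n := by rw [s₁.2 i (by omega) (by omega), hn]
  refine (ends_assign_sub (m := n) (n := n.sqrt * n.sqrt) (by simp [AExp.eval, hi₁, s₁.1])
    (s + 2) (s + 1)).seq fun η₂ s₂ => ?_
  have hs₂ : η₂ s = n.sqrt := by rw [s₂.2 s (by omega) (by omega), s₁.1]
  obtain ⟨b₁, b₂⟩ := hb s (s + 1) (s + 2) (by omega) (by omega)
  refine (ends_condProg (m := n - n.sqrt * n.sqrt) (n := n.sqrt)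
    b₁ b₂
    (by simp only [AExp.eval, s₂.1, NNRat.cast_natCast])
    (by simp only [AExp.eval, hs₂, NNRat.cast_natCast]) ?_).mono
    fun η₃ s₃ => ⟨s₃.1, fun x hx hxo => ?_⟩
  · dsimp only
    split_ifs with h
    · exact h₁ _ _ _ _ _ hs₂ s₂.1 h
    · exact h₂ _ _ _ _ _ hs₂ s₂.1 (not_lt.1 h)
  · rw [s₃.2 x (by omega) hxo, s₂.2 x (by omega) (by omega), s₁.2 x (by omega) (by omega)]

theorem computes_left : Computes fun n => n.unpair.1 := by
  have := computes_unpair (fun _ r => r) (fun t _ => t) (fun _ r => .var r) (fun t _ => .var t)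
    (fun t r s ht hr => ⟨AExp.below_var hr, AExp.below_var ht⟩)
    (fun η t r k l ht hr _ => by simp [AExp.eval, hr])
    (fun η t r k l ht hr _ => by simp [AExp.eval, ht])
  convert this using 2 with n
  rw [Nat.unpair]
  split_ifs <;> rfl

theorem computes_right : Computes fun n => n.unpair.2 := by
  have := computes_unpair (fun t _ => t) (fun t r => r - t) (fun t _ => .var t)
    (fun t r => .sub (.var r) (.var t))
    (fun t r s ht hr => ⟨AExp.below_var ht, (AExp.below_var hr).sub (AExp.below_var ht)⟩)
    (fun η t r k l ht hr _ => by simp [AExp.eval, ht])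
    (fun η t r k l ht hr h => by simp [AExp.eval, ht, hr, Nat.cast_sub h])
  convert this using 2 with n
  rw [Nat.unpair]
  split_ifs <;> rfl

theorem computes_of_eval (f : ℕ → ℕ) (e : ℕ → AExp)
    (h : ∀ (η : Val) i n, η i = (n : ℕ) → (e i).eval η = f n) : Computes f :=
  fun i o s _ _ => ⟨.assign o (e i), fun η n hn => ends_assign (h η i n hn) s o⟩

/-- Since `Computes` quantifies over the bound of the protected variables, raising the bound
reserves fresh registers for intermediate results. -/
theorem Computes.pair {f g : ℕ → ℕ} (hf : Computes f) (hg : Computes g) :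
    Computes fun n => Nat.pair (f n) (g n) := by
  intro i o s hi ho
  obtain ⟨F, hF⟩ := hf i s (s + 2) (by omega) (by omega)
  obtain ⟨G, hG⟩ := hg i (s + 1) (s + 2) (by omega) (by omega)
  refine ⟨.seq F (.seq G (pairProg s (s + 1) o (s + 2))), fun η n hn => ?_⟩
  refine (hF η n hn).seq fun η₁ s₁ => ?_
  refine (hG η₁ n (by rw [s₁.2 i (by omega) (by omega), hn])).seq fun η₂ s₂ => ?_
  refine (ends_pairProg (by omega) (by omega) (by rw [s₂.2 s (by omega) (by omega), s₁.1])
    s₂.1).mono fun η₃ s₃ => ⟨s₃.1, fun x hx hxo => ?_⟩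
  rw [s₃.2 x (by omega) hxo, s₂.2 x (by omega) (by omega), s₁.2 x (by omega) (by omega)]

theorem Computes.comp {f g : ℕ → ℕ} (hf : Computes f) (hg : Computes g) :
    Computes fun n => f (g n) := by
  intro i o s hi ho
  obtain ⟨G, hG⟩ := hg i s (s + 1) (by omega) (by omega)
  obtain ⟨F, hF⟩ := hf s o (s + 1) (by omega) (by omega)
  refine ⟨.seq G F, fun η n hn => ?_⟩
  refine (hG η n hn).seq fun η₁ s₁ => (hF η₁ _ s₁.1).mono fun η₂ s₂ => ⟨s₂.1, fun x hx hxo => ?_⟩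
  rw [s₂.2 x (by omega) hxo, s₁.2 x (by omega) (by omega)]

/-- Registers: `s` parameter, `s + 1` number of iterations, `s + 2` counter, `s + 3` accumulator, `s
+ 4` argument of `g`, and `s + 5` scratch for pairing. -/
theorem Computes.prec {f g : ℕ → ℕ} (hf : Computes f) (hg : Computes g) :
    Computes (Nat.unpaired fun z n =>
      n.rec (f z) fun y IH => g (Nat.pair z (Nat.pair y IH))) := by
  intro i o s hi ho
  obtain ⟨A, hA⟩ := computes_left i s (s + 5) (by omega) (by omega)
  obtain ⟨B, hB⟩ := computes_right i (s + 1) (s + 5) (by omega) (by omega)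
  obtain ⟨F, hF⟩ := hf s (s + 3) (s + 5) (by omega) (by omega)
  obtain ⟨G, hG⟩ := hg (s + 4) (s + 3) (s + 5) (by omega) (by omega)
  refine ⟨.seq A (.seq B (.seq F (.seq (.assign (s + 2) (.const 0)) (.seq
    (.loop (.lt (.var (s + 2)) (.var (s + 1)))
      (.seq (pairProg (s + 2) (s + 3) (s + 4) (s + 5))
        (.seq (pairProg s (s + 4) (s + 4) (s + 5))
          (.seq G (.assign (s + 2) (.add (.var (s + 2)) (.const 1)))))))
    (.assign o (.var (s + 3))))))), fun η p hp => ?_⟩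
  set z := p.unpair.1 with hz
  set n := p.unpair.2 with hn
  let r : ℕ → ℕ := fun k => k.rec (f z) fun y IH => g (Nat.pair z (Nat.pair y IH))
  refine (hA η p hp).seq fun η₁ s₁ => ?_
  refine (hB η₁ p (by rw [s₁.2 i (by omega) (by omega), hp])).seq fun η₂ s₂ => ?_
  have hs₂ : η₂ s = z := by rw [s₂.2 s (by omega) (by omega), s₁.1]
  refine (hF η₂ z hs₂).seq fun η₃ s₃ => ?_
  refine (ends_assign (n := 0) (by simp [AExp.eval]) (s + 5) (s + 2)).seq fun η₄ s₄ => ?_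
  let I : ℕ → Val → Prop := fun k η' => η' s = z ∧ η' (s + 1) = n ∧ η' (s + 2) = k ∧
    η' (s + 3) = Nat.cast (r k) ∧ ∀ x < s, η' x = η x
  have h₄ : I 0 η₄ := by
    refine ⟨?_, ?_, s₄.1, ?_, fun x hx => ?_⟩
    · rw [s₄.2 s (by omega) (by omega), s₃.2 s (by omega) (by omega), hs₂]
    · rw [s₄.2 _ (by omega) (by omega), s₃.2 _ (by omega) (by omega), s₂.1]
    · rw [s₄.2 _ (by omega) (by omega), s₃.1]
      rfl
    · rw [s₄.2 x (by omega) (by omega), s₃.2 x (by omega) (by omega),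
        s₂.2 x (by omega) (by omega), s₁.2 x (by omega) (by omega)]
  refine (Ends.loop (I := I) (m := n) (fun k hk θ h => ?_) (fun θ h => ?_)
    (Nat.zero_le _) h₄).seq fun η₅ h₅ => ?_
  · obtain ⟨i₀, i₁, i₂, i₃, i₄⟩ := h
    refine ⟨by simpa [BExp.eval, AExp.eval, i₁, i₂] using hk, ?_⟩
    refine (ends_pairProg (by omega) (by omega) i₂ i₃).seq fun θ₁ t₁ => ?_
    refine (ends_pairProg (by omega) (by omega) (by rw [t₁.2 s (by omega) (by omega), i₀])
      t₁.1).seq fun θ₂ t₂ => ?_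
    refine (hG θ₂ _ t₂.1).seq fun θ₃ t₃ => ?_
    have hk : θ₃ (s + 2) = k := by
      rw [t₃.2 _ (by omega) (by omega), t₂.2 _ (by omega) (by omega),
        t₁.2 _ (by omega) (by omega), i₂]
    refine (ends_assign (n := k + 1) (by simp [AExp.eval, hk]) (s + 5) (s + 2)).mono
      fun θ₄ t₄ => ⟨?_, ?_, t₄.1, ?_, fun x hx => ?_⟩
    · rw [t₄.2 _ (by omega) (by omega), t₃.2 _ (by omega) (by omega),
        t₂.2 _ (by omega) (by omega), t₁.2 _ (by omega) (by omega), i₀]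
    · rw [t₄.2 _ (by omega) (by omega), t₃.2 _ (by omega) (by omega),
        t₂.2 _ (by omega) (by omega), t₁.2 _ (by omega) (by omega), i₁]
    · rw [t₄.2 _ (by omega) (by omega), t₃.1]
    · rw [t₄.2 _ (by omega) (by omega), t₃.2 _ (by omega) (by omega),
        t₂.2 _ (by omega) (by omega), t₁.2 _ (by omega) (by omega), i₄ x hx]
  · simp [BExp.eval, AExp.eval, h.2.1, h.2.2.1]
  · obtain ⟨-, -, -, i₃, i₄⟩ := h₅
    refine (ends_assign (n := r n) (by simp [AExp.eval, i₃]) s o).mono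
      fun η₆ s₆ => ⟨s₆.1, fun x hx hxo => ?_⟩
    rw [s₆.2 x hx hxo, i₄ x hx]

theorem computes_of_primrec {f : ℕ → ℕ} (hf : Nat.Primrec f) : Computes f := by
  induction hf with
  | zero => exact computes_of_eval _ (fun _ => .const 0) fun _ _ _ _ => by simp [AExp.eval]
  | succ =>
    exact computes_of_eval _ (fun i => .add (.var i) (.const 1)) fun _ _ _ h => by
      simp [AExp.eval, h]
  | left => exact computes_left
  | right => exact computes_right
  | pair _ _ hf hg => exact hf.pair hg
  | comp _ _ hf hg => exact hf.comp hg
  | prec _ _ hf hg => exact hf.prec hg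

/-! ### Hardness -/

/-- Stores the value of `g` (computed by `G`) at the triple of the variables `0`, `1`, `3` in `5`. -/
def tripleProg (G : Prog) : Prog :=
  .seq (pairProg 1 3 4 6) (.seq (pairProg 0 4 4 6) G)

/-- Increments the variable `3` until `5` is zero. -/
def searchProg (G : Prog) : Prog :=
  .loop (.not (.eq (.var 5) (.const 0)))
    (.seq (.assign 3 (.add (.var 3) (.const 1))) (tripleProg G))

/-- Increments the variable `1` and sets the flag `2` with probability one half. -/
def flipProg : Prog :=
  .seq (.assign 1 (.add (.var 1) (.const 1)))
    (.choice ⟨1 / 2, by norm_num⟩ (.assign 2 (.const 1)) (.assign 2 (.const 0)))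

/-- Repeats until the flag `2` is set: search for a zero of `g` at the current value of the
variable `1`, increment this variable and set the flag with probability one half. -/
def mainLoop (G : Prog) : Prog :=
  .loop (.eq (.var 2) (.const 0)) (.seq (.assign 3 (.const 0))
    (.seq (tripleProg G) (.seq (searchProg G) flipProg)))

/-- The variables `0`, `1`, `2` have the values `x`, `y` and `0`. -/
def AtHead (x y : ℕ) (η : Val) : Prop := η 0 = x ∧ η 1 = y ∧ η 2 = 0

/-- `G` stores the value of `g` at the variable `4` in `5`, without changing the variables below
`5`. -/
def Evaluates (G : Prog) (g : ℕ → ℕ) : Prop :=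
  ∀ (η : Val) (n : ℕ), η 4 = n → Ends G η (Sets 6 η 5 (g n))

theorem ends_tripleProg {G : Prog} {g : ℕ → ℕ} (hG : Evaluates G g)
    {x y z : ℕ} {η : Val} (hx : AtHead x y η) (hz : η 3 = z) :
    Ends (tripleProg G) η fun η' => AtHead x y η' ∧ η' 3 = z ∧
      η' 5 = Nat.cast (g (Nat.pair x (Nat.pair y z))) := by
  obtain ⟨h0, h1, h2⟩ := hx
  refine (ends_pairProg (by omega) (by omega) h1 hz).seq fun η₁ s₁ => ?_
  refine (ends_pairProg (m := x) (by omega) (by omega) (by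
    rw [s₁.2 0 (by omega) (by omega), h0]) s₁.1).seq fun η₂ s₂ => ?_
  refine (hG η₂ _ s₂.1).mono fun η₃ s₃ => ?_
  have h : ∀ x : ℕ, x < 4 → η₃ x = η x := fun x hx => by
    rw [s₃.2 x (by omega) (by omega), s₂.2 x (by omega) (by omega), s₁.2 x (by omega) (by omega)]
  exact ⟨⟨by rw [h 0 (by omega), h0], by rw [h 1 (by omega), h1], by rw [h 2 (by omega), h2]⟩,
    by rw [h 3 (by omega), hz], s₃.1⟩

theorem ends_searchBody {G : Prog} {g : ℕ → ℕ} (hG : Evaluates G g)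
    {x y z : ℕ} {η : Val} (hx : AtHead x y η) (hz : η 3 = z) :
    Ends (.seq (.assign 3 (.add (.var 3) (.const 1))) (tripleProg G)) η fun η' => AtHead x y η' ∧
      η' 3 = ((z + 1 : ℕ) : ℚ≥0) ∧ η' 5 = Nat.cast (g (Nat.pair x (Nat.pair y (z + 1)))) := by
  refine (ends_assign (n := z + 1) (by simp [AExp.eval, hz]) 6 3).seq fun η₁ s₁ => ?_
  refine ends_tripleProg hG ⟨?_, ?_, ?_⟩ s₁.1
  · rw [s₁.2 0 (by omega) (by omega), hx.1]
  · rw [s₁.2 1 (by omega) (by omega), hx.2.1]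
  · rw [s₁.2 2 (by omega) (by omega), hx.2.2]

/-- From the head of the main loop to the search. -/
theorem steps_search {G : Prog} {g : ℕ → ℕ} (hG : Evaluates G g)
    {x y : ℕ} {η : Val} (hx : AtHead x y η) (a : ℚ≥0) (θ : List Dir) :
    ∃ η', AtHead x y η' ∧ η' 3 = 0 ∧ η' 5 = Nat.cast (g (Nat.pair x (Nat.pair y 0))) ∧
      Steps ⟨Ctl.prog (mainLoop G), η, a, θ⟩
        ⟨Ctl.seq (Ctl.prog (.seq (searchProg G) flipProg)) (mainLoop G), η', a, θ⟩ := by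
  obtain ⟨η₁, r₁, s₁⟩ := ends_assign (η := η) (e := .const 0) (n := 0) (by simp [AExp.eval]) 6 3
  obtain ⟨η₂, r₂, hx₂, h3, h5⟩ := ends_tripleProg (x := x) (y := y) hG ⟨by
      rw [s₁.2 0 (by omega) (by omega), hx.1], by rw [s₁.2 1 (by omega) (by omega), hx.2.1], by
      rw [s₁.2 2 (by omega) (by omega), hx.2.2]⟩ s₁.1
  refine ⟨η₂, hx₂, by simpa using h3, h5, .head (step_loop_true ?_ _ a θ) ?_⟩
  · simp [BExp.eval, AExp.eval, hx.2.2]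
  · exact (((r₁.steps_prog_seq a θ).trans (r₂.steps_prog_seq a θ)).andThen (mainLoop G))

/-- The search never ends: the states at the beginning of its body recur along a deterministic run,
so `outcome_eq_zero` applies. -/
theorem outcome_mainLoop_of_forall_ne {G : Prog} {g : ℕ → ℕ} (hG : Evaluates G g)
    {x y : ℕ}
    (hg : ∀ z, g (Nat.pair x (Nat.pair y z)) ≠ 0) {η : Val} (hx : AtHead x y η) (a : ℚ≥0)
    (θ : List Dir) (v : Var) : outcome v ⟨Ctl.prog (mainLoop G), η, a, θ⟩ = 0 := by
  obtain ⟨η₁, hx₁, h3, h5, r₁⟩ := steps_search hG hx a θ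
  rw [r₁.outcome_eq]
  have hb : ∀ (η : Val) z, η 5 = Nat.cast (g (Nat.pair x (Nat.pair y z))) →
      (BExp.not (.eq (.var 5) (.const 0))).eval η = true := fun η z h => by
    simp [BExp.eval, AExp.eval, h, hg z]
  -- The state at the beginning of the search body, inside the contexts of the search loop, the coin
  -- toss and the main loop.
  let σ : Val → State := fun η => ((State.mk (Ctl.seq (Ctl.prog
    (.seq (.assign 3 (.add (.var 3) (.const 1))) (tripleProg G))) (searchProg G)) η a θ).andThen
      flipProg).andThen (mainLoop G)
  have h₁ := step_loop_true (hb η₁ 0 h5)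
    (.seq (.assign 3 (.add (.var 3) (.const 1))) (tripleProg G)) a θ
  have h₂ : State.step ⟨Ctl.seq (Ctl.prog (.seq (searchProg G) flipProg)) (mainLoop G),
      η₁, a, θ⟩ none = some (σ η₁) :=
    step_andThen_of_step (step_andThen_of_step h₁ flipProg) (mainLoop G)
  rw [outcome_of_step h₂]
  refine outcome_eq_zero (S := {τ | ∃ η z, AtHead x y η ∧ η 3 = ((z : ℕ) : ℚ≥0) ∧ τ = σ η}) ?_ v
    ⟨η₁, 0, hx₁, by simpa using h3, rfl⟩
  rintro _ ⟨η, z, hx, hz, rfl⟩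
  obtain ⟨η', r, hx', h3', h5'⟩ := ends_searchBody hG hx hz
  refine ⟨σ η', ⟨η', z + 1, hx', h3', rfl⟩, .tail' (((r.steps_seq a θ).andThen _).andThen _) ?_⟩
  exact step_andThen_of_step (step_andThen_of_step (step_loop_true (hb η' _ h5') _ a θ) flipProg)
    (mainLoop G)

/-- The search succeeds and the coin is tossed: `L` sets the flag, leaves the loop and contributes
`1 * (a / 2)`; `R` returns to the head of the loop with `y + 1` and the remaining mass. -/
theorem outcome_mainLoop_of_exists_eq {G : Prog} {g : ℕ → ℕ} (hG : Evaluates G g)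
    {x y : ℕ}
    (hg : ∃ z, g (Nat.pair x (Nat.pair y z)) = 0) {η : Val} (hx : AtHead x y η) (a : ℚ≥0)
    (θ : List Dir) : ∃ η' θ', AtHead x (y + 1) η' ∧
      outcome 2 ⟨Ctl.prog (mainLoop G), η, a, θ⟩ =
        (((a / 2 : ℚ≥0) : ℝ≥0) : ℝ≥0∞) + outcome 2 ⟨Ctl.prog (mainLoop G), η', a / 2, θ'⟩ := by
  obtain ⟨η₁, hx₁, h3, h5, r₁⟩ := steps_search hG hx a θ
  have hfind := Nat.find_spec hg
  obtain ⟨η₂, r₂, hx₂, -, -⟩ : Ends (searchProg G) η₁ fun η' => AtHead x y η' ∧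
      η' 3 = Nat.cast (Nat.find hg) ∧
        η' 5 = Nat.cast (g (Nat.pair x (Nat.pair y (Nat.find hg)))) := by
    -- The value at `z = 0` was computed before the loop, so exactly `Nat.find hg` iterations are
    -- made.
    refine Ends.loop (I := fun z η' => AtHead x y η' ∧ η' 3 = (z : ℚ≥0) ∧
      η' 5 = Nat.cast (g (Nat.pair x (Nat.pair y z)))) (fun z hz η h => ⟨?_, ?_⟩) (fun η h => ?_)
      (Nat.zero_le _) ⟨hx₁, by simpa using h3, h5⟩
    · simp [BExp.eval, AExp.eval, h.2.2, Nat.find_min hg hz]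
    · exact ends_searchBody hG h.1 h.2.1
    · simp [BExp.eval, AExp.eval, h.2.2, hfind]
  obtain ⟨η₃, r₃, s₃⟩ := ends_assign (η := η₂) (e := .add (.var 1) (.const 1)) (n := y + 1)
    (by simp [AExp.eval, hx₂.2.1]) 6 1
  have hx₃ : AtHead x (y + 1) η₃ :=
    ⟨by rw [s₃.2 0 (by omega) (by omega), hx₂.1], s₃.1,
      by rw [s₃.2 2 (by omega) (by omega), hx₂.2.2]⟩
  have r := r₁.trans (((r₂.steps_prog_seq a θ).trans (r₃.steps_prog_seq a θ)).andThen (mainLoop G))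
  rw [r.outcome_eq]
  have h1 : Runs (.assign 2 (.const 1)) η₃ (η₃.update 2 (1 : ℕ)) := .assign (by simp [AExp.eval])
  have h0 : Runs (.assign 2 (.const 0)) η₃ (η₃.update 2 (0 : ℕ)) := .assign (by simp [AExp.eval])
  refine ⟨η₃.update 2 (0 : ℕ), θ ++ [Dir.R], ⟨by simp [hx₃.1], by simp [hx₃.2.1], by simp⟩, ?_⟩
  have ha : a * (1 / 2) = a / 2 := by ring
  have ha' : a * (1 - 1 / 2) = a / 2 := by
    rw [show (1 : ℚ≥0) - 1 / 2 = 1 / 2 from tsub_eq_of_eq_add (by norm_num), ha]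
  rw [outcome_of_choice (σ := State.andThen _ _)
    (τ₁ := State.andThen (mainLoop G) ⟨Ctl.prog (.assign 2 (.const 1)), η₃, a / 2, θ ++ [Dir.L]⟩)
    (τ₂ := State.andThen (mainLoop G) ⟨Ctl.prog (.assign 2 (.const 0)), η₃, a / 2, θ ++ [Dir.R]⟩)
    rfl ?_ ?_]
  · congr 1
    · have hs := (h1.steps_seq (Q := mainLoop G) (a / 2) (θ ++ [Dir.L])).tail
        (step_loop_false (by simp [BExp.eval, AExp.eval]) _ _ _)
      refine (Steps.outcome_eq hs 2).trans ?_
      rw [outcome_done]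
      simp
    · exact (h0.steps_seq (Q := mainLoop G) (a / 2) (θ ++ [Dir.R])).outcome_eq 2
  · exact step_andThen_of_step (by simp only [State.step, Ctl.step, Prog.step, ha]) _
  · exact step_andThen_of_step (by simp only [State.step, Ctl.step, Prog.step, ha']) _

/-! ### Bounds on the outcome of the main loop -/

theorem coe_half_add_half (a : ℚ≥0) : (((a / 2 : ℚ≥0) : ℝ≥0) : ℝ≥0∞) +
    (((a / 2 : ℚ≥0) : ℝ≥0) : ℝ≥0∞) = ((a : ℝ≥0) : ℝ≥0∞) := by
  rw [← ENNReal.coe_add, ← NNRat.cast_add, add_halves]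

/-- Every successful round pays out half of the remaining mass, so after `m` rounds at most `a / 2 ^
m` is missing. -/
theorem le_outcome_mainLoop {G : Prog} {g : ℕ → ℕ} (hG : Evaluates G g)
    {x : ℕ} (hg : ∀ y, ∃ z, g (Nat.pair x (Nat.pair y z)) = 0) (m : ℕ) :
    ∀ {y : ℕ} {η : Val} (_ : AtHead x y η) (a : ℚ≥0) (θ : List Dir), ((a : ℝ≥0) : ℝ≥0∞) ≤
      outcome 2 ⟨Ctl.prog (mainLoop G), η, a, θ⟩ + (((a / 2 ^ m : ℚ≥0) : ℝ≥0) : ℝ≥0∞) := by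
  induction m with
  | zero => intro y η _ a θ; simp
  | succ m ih =>
    intro y η hx a θ
    obtain ⟨η', θ', hx', h⟩ := outcome_mainLoop_of_exists_eq hG (hg y) hx a θ
    rw [h, add_assoc, ← coe_half_add_half a, pow_succ', ← div_div]
    gcongr
    exact ih hx' _ _

/-- At `y = n` the outcome is `0 < a`. Going down from there, a successful round adds `a / 2` to
both sides of the strict inequality, and an unsuccessful one gives outcome `0`. -/
theorem outcome_mainLoop_lt {G : Prog} {g : ℕ → ℕ} (hG : Evaluates G g)
    {x n : ℕ} (hn : ∀ z, g (Nat.pair x (Nat.pair n z)) ≠ 0)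
    {y : ℕ} (hy : y ≤ n) {η : Val} (hx : AtHead x y η) {a : ℚ≥0} (ha : 0 < a) (θ : List Dir) :
    outcome 2 ⟨Ctl.prog (mainLoop G), η, a, θ⟩ < ((a : ℝ≥0) : ℝ≥0∞) := by
  induction hy using Nat.decreasingInduction generalizing η a θ with
  | self =>
    rw [outcome_mainLoop_of_forall_ne hG hn hx]
    simpa using ha
  | of_succ y hy ih =>
    by_cases hg : ∃ z, g (Nat.pair x (Nat.pair y z)) = 0
    · obtain ⟨η', θ', hx', h⟩ := outcome_mainLoop_of_exists_eq hG hg hx a θ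
      rw [h, ← coe_half_add_half a]
      exact ENNReal.add_lt_add_left ENNReal.coe_ne_top (ih hx' (by positivity) θ')
    · rw [outcome_mainLoop_of_forall_ne hG (by simpa using hg) hx]
      simpa using ha

theorem expectedOutcome_mainLoop_lt_iff {G : Prog} {g : ℕ → ℕ} (hG : Evaluates G g)
    (x : ℕ) :
    expectedOutcome (.seq (.assign 0 (.const x)) (mainLoop G)) 0 2 < 1 ↔
      ∃ y, ∀ z, g (Nat.pair x (Nat.pair y z)) ≠ 0 := by
  have h : Runs (.assign 0 (.const x)) 0 ((0 : Val).update 0 x) := .assign (by simp [AExp.eval])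
  rw [expectedOutcome_eq, initState, (h.steps_prog_seq 1 []).outcome_eq]
  -- The zero valuation already provides `y = 0` and an unset flag.
  have hx : AtHead x 0 ((0 : Val).update 0 x) := ⟨by simp, by simp, by simp⟩
  constructor
  · contrapose!
    intro hg
    refine ENNReal.le_of_forall_pos_le_add fun ε hε _ => ?_
    obtain ⟨m, hm⟩ := exists_pow_lt_of_lt_one hε (show (1 / 2 : ℝ≥0) < 1 by
      rw [div_lt_one] <;> norm_num)
    have := le_outcome_mainLoop hG hg m hx 1 []
    simp only [NNRat.cast_one, ENNReal.coe_one] at this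
    refine this.trans ?_
    gcongr
    refine le_trans (le_of_eq ?_) hm.le
    push_cast
    simp
  · rintro ⟨n, hn⟩
    simpa using outcome_mainLoop_lt hG hn (Nat.zero_le n) hx one_pos []

/-! ### Effectiveness of the reduction -/

/-- Adding `1` sends the code `c` to `2 * c + 1`. This closed form shows that the code of a numeral
is primitive recursive in the number. -/
theorem ratOfNat_two_pow_sub_one (n : ℕ) : ratOfNat (2 ^ n - 1) = n := by
  induction n with
  | zero => rw [ratOfNat]; simp
  | succ n ih =>
    have := Nat.one_le_two_pow (n := n)
    rw [ratOfNat, dif_neg (by rw [pow_succ]; omega), if_pos (by rw [pow_succ]; omega),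
      show (2 ^ (n + 1) - 1) / 2 = 2 ^ n - 1 by rw [pow_succ]; omega, ih]
    simp

theorem ratCode_natCast (n : ℕ) : ratCode n = 2 ^ n - 1 := by
  rw [← ratOfNat_two_pow_sub_one, ratCode_ratOfNat]

theorem nat_pow_two_primrec : Primrec fun n : ℕ => 2 ^ n :=
  Primrec₂.comp (f := fun a b : ℕ => a ^ b) (Primrec₂.unpaired'.1 Nat.Primrec.pow)
    (Primrec.const 2) Primrec.id

/-- The initialization of the variable `0` by `n` depends computably on `n`. -/
theorem primrec_seq_assign (P : Prog) :
    Primrec fun n : ℕ => Prog.seq (.assign 0 (.const n)) P := by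
  refine Primrec.encode_iff.1 ?_
  have : Primrec fun n : ℕ =>
      4 * Nat.pair (4 * Nat.pair 0 (5 * (2 ^ n - 1))) P.code + 1 := by
    refine Primrec.succ.comp (Primrec.nat_mul.comp (Primrec.const 4)
      (Primrec₂.natPair.comp ?_ (Primrec.const _)))
    refine Primrec.nat_mul.comp (Primrec.const 4) (Primrec₂.natPair.comp (Primrec.const 0) ?_)
    exact Primrec.nat_mul.comp (Primrec.const 5)
      (Primrec.nat_sub.comp nat_pow_two_primrec (Primrec.const 1))
  refine this.of_eq fun n => ?_
  rw [← ratCode_natCast]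
  rfl

/-- A `Σ₂⁰` set has a primitive recursive matrix on codes. -/
theorem IsSigma2.exists_primrec {β : Type} [Primcodable β] {C : Set β} (hC : IsSigma2 C) :
    ∃ g : ℕ → ℕ, Nat.Primrec g ∧ ∀ x : β, x ∈ C ↔
      ∃ y, ∀ z, g (Nat.pair (Encodable.encode x) (Nat.pair y z)) ≠ 0 := by
  obtain ⟨R, ⟨hd, hR⟩, hC⟩ := hC
  obtain ⟨c, hc⟩ := Nat.Partrec.Code.exists_code.1 hR
  -- The last component of the triple codes the original `z` together with a step bound. The new
  -- matrix is `0` iff the decision procedure answers false, whose code is `0`, on `(x, y, z)`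
  -- within this bound; so the bound is absorbed by the universal quantifier.
  let arg : ℕ → ℕ := fun n => Nat.pair n.unpair.1
    (Nat.pair n.unpair.2.unpair.1 n.unpair.2.unpair.2.unpair.1)
  have h1 : Primrec fun n : ℕ => n.unpair.1 := Primrec.fst.comp Primrec.unpair
  have h2 : Primrec fun n : ℕ => n.unpair.2 := Primrec.snd.comp Primrec.unpair
  have harg : Primrec arg := Primrec₂.natPair.comp h1
    (Primrec₂.natPair.comp (h1.comp h2) (h1.comp (h2.comp h2)))
  have hs : Primrec fun n : ℕ => n.unpair.2.unpair.2.unpair.2 := h2.comp (h2.comp h2)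
  have hev : ∀ {s a : ℕ → ℕ}, Primrec s → Primrec a →
      Primrec fun n => Nat.Partrec.Code.evaln (s n) c (a n) := fun hs ha =>
    Nat.Partrec.Code.primrec_evaln.comp ((hs.pair (Primrec.const c)).pair ha)
  have hite : ∀ {f : ℕ → Option ℕ}, Primrec f → Primrec fun n => if f n = some 0 then 0 else 1 :=
    fun hf => Primrec.ite (Primrec.eq.comp hf (Primrec.const _)) (Primrec.const _) (Primrec.const _)
  refine ⟨fun n => if Nat.Partrec.Code.evaln n.unpair.2.unpair.2.unpair.2 c (arg n) = some 0
    then 0 else 1, Primrec.nat_iff.1 (hite (hev hs harg)), fun x => ?_⟩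
  have hd' : ∀ y z, Decidable (R x y z) := fun y z => hd (x, y, z)
  have he : ∀ y z, c.eval (Nat.pair (Encodable.encode x) (Nat.pair y z)) =
      Part.some (Encodable.encode (decide (R x y z))) := fun y z => by
    rw [hc]
    have : Nat.pair (Encodable.encode x) (Nat.pair y z) = Encodable.encode (x, y, z) := rfl
    simp only [this, Encodable.encodek]
    simp
  rw [hC]
  refine exists_congr fun y => ⟨fun h z => ?_, fun h z => ?_⟩
  · simp only [arg, Nat.unpair_pair]
    rw [if_neg]
    · exact one_ne_zero
    · intro h0
      have := Nat.Partrec.Code.evaln_sound (Option.mem_def.2 h0)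
      rw [he] at this
      simp [h] at this
  · by_contra hz
    have : (0 : ℕ) ∈ c.eval (Nat.pair (Encodable.encode x) (Nat.pair y z)) := by
      rw [he]; simp [hz]
    obtain ⟨s, hs⟩ := Nat.Partrec.Code.evaln_complete.1 this
    refine h (Nat.pair z s) (if_pos ?_)
    simpa [arg] using hs

theorem isSigma2Hard_REXP : IsSigma2Hard REXP := by
  intro β _ C hC
  obtain ⟨g, hg, hC⟩ := hC.exists_primrec
  -- Input in `4`, output in `5` and scratch variables from `6` on: this is `Evaluates G g`.
  obtain ⟨G, hG⟩ := computes_of_primrec hg 4 5 6 (by omega) (by omega)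
  refine ⟨fun b => (.seq (.assign 0 (.const (Encodable.encode b : ℕ))) (mainLoop G), 0, 2, 1),
    ?_, fun b => ?_⟩
  · exact (((primrec_seq_assign (mainLoop G)).comp Primrec.encode).pair (Primrec.const _)).to_comp
  · beta_reduce
    rw [hC, ← expectedOutcome_mainLoop_lt_iff hG]
    simp [REXP]

/-- Non-halting is `Π₁⁰` and therefore `Σ₂⁰` with a dummy existential quantifier. A reduction of it
to an enumerable set would make it enumerable. -/
theorem not_rePred_of_isSigma2Hard {α : Type} [Primcodable α] {A : Set α} (hA : IsSigma2Hard A) :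
    ¬ REPred fun x => x ∈ A := by
  intro h
  obtain ⟨f, hf, hK⟩ := hA Nat.Partrec.Code {c | ¬ (c.eval 0).Dom} (by
    refine ⟨fun c _ s => Nat.Partrec.Code.evaln s c 0 = none,
      PrimrecPred.computablePred (Primrec.eq.comp (Nat.Partrec.Code.primrec_evaln.comp
        (((Primrec.snd.comp Primrec.snd).pair Primrec.fst).pair (Primrec.const 0)))
        (Primrec.const none)), fun c => ?_⟩
    simp only [Set.mem_ofPred_eq, exists_const, Part.dom_iff_mem, not_exists,
      Nat.Partrec.Code.evaln_complete, Option.eq_none_iff_forall_not_mem]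
    exact forall_comm)
  refine ComputablePred.halting_problem_not_re 0 (REPred.of_eq ?_ fun c => (hK c).symm)
  exact Partrec.comp h hf

/-! ### Primitive recursive arithmetic of the nonnegative rationals -/

/-- Course-of-values recursion with two recursive calls. -/
theorem primrec_strong_rec₂ {α σ : Type} [Primcodable α] [Primcodable σ] (f : α → ℕ → σ) (d : σ)
    {s₁ s₂ : ℕ → ℕ} (h₁ : Primrec s₁) (h₂ : Primrec s₂) {G : α × ℕ → σ × σ → σ} (hG : Primrec₂ G)
    (H : ∀ a n, f a n = G (a, n) (if s₁ n < n then f a (s₁ n) else d,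
      if s₂ n < n then f a (s₂ n) else d)) : Primrec₂ f := by
  have hlen : Primrec fun p : α × List σ => p.2.length := Primrec.list_length.comp Primrec.snd
  have hget : ∀ {s : ℕ → ℕ}, Primrec s → Primrec fun p : α × List σ => p.2.getD (s p.2.length) d :=
    fun hs => (Primrec.list_getD d).comp Primrec.snd (hs.comp hlen)
  have hg : Primrec₂ fun (a : α) (l : List σ) => some (G (a, l.length)
      (l.getD (s₁ l.length) d, l.getD (s₂ l.length) d)) :=
    Primrec.option_some.comp (hG.comp (Primrec.fst.pair hlen) ((hget h₁).pair (hget h₂)))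
  refine Primrec.nat_strong_rec f hg fun a n => ?_
  have : ∀ k, ((List.range n).map (f a)).getD k d = if k < n then f a k else d := fun k => by
    split_ifs with h <;> simp [List.getD, h]
  simp only [List.length_map, List.length_range, this]
  rw [← H]

theorem primrec_unpair_fst : Primrec fun n : ℕ => n.unpair.1 := Primrec.fst.comp Primrec.unpair

theorem primrec_unpair_snd : Primrec fun n : ℕ => n.unpair.2 := Primrec.snd.comp Primrec.unpair

theorem primrec_fracCode : Primrec₂ fracCode := by
  have h : Primrec₂ fun (_ : Unit) (n : ℕ) => fracCode n.unpair.1 n.unpair.2 := by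
    have ha : Primrec fun p : (Unit × ℕ) × (ℕ × ℕ) => p.1.2.unpair.1 :=
      primrec_unpair_fst.comp (Primrec.snd.comp Primrec.fst)
    have hb : Primrec fun p : (Unit × ℕ) × (ℕ × ℕ) => p.1.2.unpair.2 :=
      primrec_unpair_snd.comp (Primrec.snd.comp Primrec.fst)
    refine primrec_strong_rec₂ (s₁ := fun n => Nat.pair (n.unpair.1 - n.unpair.2) n.unpair.2)
      (s₂ := fun n => Nat.pair (n.unpair.2 - n.unpair.1) n.unpair.1)
      (G := fun p v => if p.2.unpair.1 = 0 ∨ p.2.unpair.2 = 0 then 0 else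
        if p.2.unpair.2 ≤ p.2.unpair.1 then 2 * v.1 + 1 else 2 * v.2) _ 0 ?_ ?_ ?_ ?_
    · exact Primrec₂.natPair.comp
        (Primrec.nat_sub.comp primrec_unpair_fst primrec_unpair_snd) primrec_unpair_snd
    · exact Primrec₂.natPair.comp
        (Primrec.nat_sub.comp primrec_unpair_snd primrec_unpair_fst) primrec_unpair_fst
    · refine Primrec.ite ((Primrec.eq.comp ha (Primrec.const 0)).or
        (Primrec.eq.comp hb (Primrec.const 0))) (Primrec.const 0) (Primrec.ite
        (Primrec.nat_le.comp hb ha) ?_ ?_)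
      · exact Primrec.nat_double_succ.comp (Primrec.fst.comp Primrec.snd)
      · exact Primrec.nat_double.comp (Primrec.snd.comp Primrec.snd)
    · intro _ n
      obtain ⟨⟨a, b⟩, rfl⟩ : ∃ p : ℕ × ℕ, Nat.pair p.1 p.2 = n := ⟨n.unpair, n.pair_unpair⟩
      simp only [Nat.unpair_pair]
      rw [fracCode]
      by_cases h0 : a = 0 ∨ b = 0
      · simp [h0]
      rw [dif_neg h0, if_neg h0]
      by_cases hba : b ≤ a
      · rw [if_pos hba, if_pos hba,
          if_pos (Nat.pair_lt_pair_left b (show a - b < a by omega))]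
      · rw [if_neg hba, if_neg hba, if_pos]
        -- The recursion needs the code of `(b - a, a)` to be below that of `(a, b)`, which is `b *
        -- b + a` because `a < b`.
        rw [Nat.pair, Nat.pair, if_pos (show a < b by omega)]
        obtain ⟨c, rfl⟩ := Nat.exists_eq_add_of_le (not_le.1 hba).le
        have ha : 1 ≤ a := by omega
        have hc : 1 ≤ c := by omega
        rw [Nat.add_sub_cancel_left]
        split_ifs <;> nlinarith [Nat.mul_le_mul ha hc, Nat.mul_le_mul_right c ha]
  refine (h.comp (Primrec.const ()) Primrec₂.natPair).to₂.of_eq fun a b => by simp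

/-- Numerator and denominator of the rational with code `n`. -/
def fracOfNat (n : ℕ) : ℕ × ℕ :=
  if n = 0 then (0, 1)
  else if n % 2 = 1 then ((fracOfNat (n / 2)).1 + (fracOfNat (n / 2)).2, (fracOfNat (n / 2)).2)
  else ((fracOfNat (n / 2)).2, (fracOfNat (n / 2)).2 + (fracOfNat (n / 2)).1)
termination_by n
decreasing_by all_goals omega

theorem fracOfNat_spec (n : ℕ) :
    (fracOfNat n).2 ≠ 0 ∧ ratOfNat n = ((fracOfNat n).1 : ℚ≥0) / (fracOfNat n).2 := by
  induction n using Nat.strong_induction_on with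
  | _ n ih =>
    rw [fracOfNat, ratOfNat]
    split_ifs with h0 h1
    · simp
    all_goals
      obtain ⟨h2, h3⟩ := ih (n / 2) (by omega)
      have : ((fracOfNat (n / 2)).2 : ℚ≥0) ≠ 0 := by exact_mod_cast h2
      refine ⟨by simp [h2], ?_⟩
      rw [h3]
      push_cast
    · field_simp
    · have : ((fracOfNat (n / 2)).2 + (fracOfNat (n / 2)).1 : ℚ≥0) ≠ 0 := by positivity
      field_simp

theorem primrec_fracOfNat : Primrec fracOfNat := by
  have h : Primrec₂ fun (_ : Unit) n => fracOfNat n := by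
    have h2 : Primrec fun n : ℕ => n / 2 := Primrec.nat_div.comp Primrec.id (Primrec.const 2)
    have hn : Primrec fun p : (Unit × ℕ) × ((ℕ × ℕ) × (ℕ × ℕ)) => p.1.2 :=
      Primrec.snd.comp Primrec.fst
    have ha : Primrec fun p : (Unit × ℕ) × ((ℕ × ℕ) × (ℕ × ℕ)) => p.2.1.1 :=
      Primrec.fst.comp (Primrec.fst.comp Primrec.snd)
    have hb : Primrec fun p : (Unit × ℕ) × ((ℕ × ℕ) × (ℕ × ℕ)) => p.2.1.2 :=
      Primrec.snd.comp (Primrec.fst.comp Primrec.snd)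
    refine primrec_strong_rec₂ (G := fun p v => if p.2 = 0 then (0, 1) else
      if p.2 % 2 = 1 then (v.1.1 + v.1.2, v.1.2) else (v.1.2, v.1.2 + v.1.1)) _ (0, 0) h2 h2 ?_ ?_
    · refine Primrec.ite (Primrec.eq.comp hn (Primrec.const 0)) (Primrec.const _) (Primrec.ite
        (Primrec.eq.comp (Primrec.nat_mod.comp hn (Primrec.const 2)) (Primrec.const 1)) ?_ ?_)
      · exact (Primrec.nat_add.comp ha hb).pair hb
      · exact hb.pair (Primrec.nat_add.comp hb ha)
    · intro _ n
      rw [fracOfNat]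
      by_cases h0 : n = 0
      · simp [h0]
      · simp only [h0, if_neg, not_false_eq_true, show n / 2 < n by omega, if_true]
  exact h.comp (Primrec.const ()) Primrec.id

/-- Numerator and denominator of a nonnegative rational, not necessarily coprime. -/
def toFrac (q : ℚ≥0) : ℕ × ℕ := fracOfNat (ratCode q)

theorem toFrac_snd_ne_zero (q : ℚ≥0) : ((toFrac q).2 : ℚ≥0) ≠ 0 := by
  exact_mod_cast (fracOfNat_spec (ratCode q)).1

theorem toFrac_div (q : ℚ≥0) : ((toFrac q).1 : ℚ≥0) / (toFrac q).2 = q := by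
  rw [toFrac, ← (fracOfNat_spec (ratCode q)).2, ratOfNat_ratCode]

theorem primrec_ratOfNat : Primrec ratOfNat := Primrec.ofNat ℚ≥0

theorem primrec_toFrac : Primrec toFrac :=
  primrec_fracOfNat.comp (Primrec.encode (α := ℚ≥0))

/-- A function to the nonnegative rationals is primitive recursive if it is given by primitive
recursive fractions. -/
theorem primrec_of_frac {α : Type} [Primcodable α] {f : α → ℚ≥0} {a b : α → ℕ} (ha : Primrec a)
    (hb : Primrec b) (hb0 : ∀ x, (b x : ℚ≥0) ≠ 0) (h : ∀ x, f x * b x = a x) : Primrec f :=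
  (primrec_ratOfNat.comp (primrec_fracCode.comp ha hb)).of_eq fun x => by
    rw [ratOfNat_fracCode _ _ (by exact_mod_cast hb0 x), ← h, mul_div_cancel_right₀ _ (hb0 x)]

theorem primrec_frac {α : Type} [Primcodable α] {f : α → ℚ≥0} (hf : Primrec f) :
    ∃ a b : α → ℕ, Primrec a ∧ Primrec b ∧ ∀ x, (b x : ℚ≥0) ≠ 0 ∧ f x = a x / b x :=
  ⟨fun x => (toFrac (f x)).1, fun x => (toFrac (f x)).2, Primrec.fst.comp (primrec_toFrac.comp hf),
    Primrec.snd.comp (primrec_toFrac.comp hf), fun _ =>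
      ⟨toFrac_snd_ne_zero _, (toFrac_div _).symm⟩⟩

section

variable {α : Type} [Primcodable α] {f g : α → ℚ≥0}

theorem primrec_nnrat_add (hf : Primrec f) (hg : Primrec g) : Primrec fun x => f x + g x := by
  obtain ⟨a, b, ha, hb, h⟩ := primrec_frac hf
  obtain ⟨c, d, hc, hd, h'⟩ := primrec_frac hg
  refine primrec_of_frac (Primrec.nat_add.comp (Primrec.nat_mul.comp ha hd)
    (Primrec.nat_mul.comp hc hb)) (Primrec.nat_mul.comp hb hd) (fun _ => ?_) fun x => ?_
  · push_cast; exact mul_ne_zero (h _).1 (h' _).1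
  · have := (h x).1
    have := (h' x).1
    rw [(h x).2, (h' x).2]
    push_cast
    field_simp

theorem primrec_nnrat_sub (hf : Primrec f) (hg : Primrec g) : Primrec fun x => f x - g x := by
  obtain ⟨a, b, ha, hb, h⟩ := primrec_frac hf
  obtain ⟨c, d, hc, hd, h'⟩ := primrec_frac hg
  refine primrec_of_frac (Primrec.nat_sub.comp (Primrec.nat_mul.comp ha hd)
    (Primrec.nat_mul.comp hc hb)) (Primrec.nat_mul.comp hb hd) (fun _ => ?_) fun x => ?_
  · push_cast; exact mul_ne_zero (h _).1 (h' _).1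
  · have := (h x).1
    have := (h' x).1
    rw [(h x).2, (h' x).2, tsub_mul]
    push_cast
    congr 1 <;> field_simp

theorem primrec_nnrat_mul (hf : Primrec f) (hg : Primrec g) : Primrec fun x => f x * g x := by
  obtain ⟨a, b, ha, hb, h⟩ := primrec_frac hf
  obtain ⟨c, d, hc, hd, h'⟩ := primrec_frac hg
  refine primrec_of_frac (Primrec.nat_mul.comp ha hc) (Primrec.nat_mul.comp hb hd)
    (fun _ => ?_) fun x => ?_
  · push_cast; exact mul_ne_zero (h _).1 (h' _).1
  · have := (h x).1
    have := (h' x).1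
    rw [(h x).2, (h' x).2]
    push_cast
    field_simp

/-- Truncated subtraction decides the order: `f x < g x` iff `g x - f x` is not `0`. -/
theorem primrecPred_nnrat_lt (hf : Primrec f) (hg : Primrec g) :
    PrimrecPred fun x => f x < g x :=
  (Primrec.eq.comp (primrec_nnrat_sub hg hf) (Primrec.const 0)).not.of_eq fun _ => by
    rw [tsub_eq_zero_iff_le, not_le]

theorem primrecPred_nnrat_le (hf : Primrec f) (hg : Primrec g) :
    PrimrecPred fun x => f x ≤ g x :=
  (primrecPred_nnrat_lt hg hf).not.of_eq fun _ => not_lt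

end

/-- For `n > 1` the probability with code `n` is `1 / (1 + y)`, where `y > 0` has code `n - 1`, so
as a rational it has code `2 * (n - 1)`. The formula also gives `0` for `n = 0`, while `n = 1` is
the probability `1`, with rational code `1`. -/
theorem primrec_probOfNat : Primrec fun n => (probOfNat n).1 := by
  have h : Primrec fun n : ℕ => ratOfNat (if n = 1 then 1 else 2 * (n - 1)) :=
    primrec_ratOfNat.comp (Primrec.ite (Primrec.eq.comp Primrec.id (Primrec.const 1))
      (Primrec.const 1) (Primrec.nat_double.comp Primrec.pred))
  refine h.of_eq fun n => ?_
  rcases n with _ | _ | n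
  · rw [ratOfNat]; rfl
  · rw [ratOfNat, if_pos rfl, dif_neg one_ne_zero, if_pos rfl]
    simp [probOfNat, ratOfNat]
  · rw [ratOfNat, if_neg (by omega), dif_neg (by omega), if_neg (by omega)]
    simp [probOfNat]

/-! ### Primitive recursive evaluation of expressions -/

/-- Valuations as association lists. -/
abbrev Env : Type := List (ℕ × ℚ≥0)

def Env.val (l : Env) (x : ℕ) : ℚ≥0 := (List.lookup x l).getD 0

theorem primrec_env_val : Primrec₂ Env.val :=
  Primrec.option_getD.comp (Primrec.listLookup.comp Primrec.snd Primrec.fst) (Primrec.const 0)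

theorem Env.val_cons (l : Env) (x y : ℕ) (q : ℚ≥0) :
    Env.val ((y, q) :: l) x = if x = y then q else l.val x := by
  rw [Env.val, List.lookup_cons]
  split_ifs with h
  · simp [h]
  · simp [beq_eq_false_iff_ne.2 h, Env.val]

/-- The elements of a multiset of natural numbers, from the differences of the sorted list. -/
def raiseList (l : List ℕ) : List ℕ :=
  (l.foldl (fun (s : ℕ × List ℕ) m => (m + s.1, (m + s.1) :: s.2)) (0, [])).2

theorem raiseList_eq (l : List ℕ) : raiseList l = (Denumerable.raise l 0).reverse := by
  have : ∀ (l : List ℕ) n acc, (l.foldl (fun (s : ℕ × List ℕ) m => (m + s.1, (m + s.1) :: s.2))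
      (n, acc)).2 = (Denumerable.raise l n).reverse ++ acc := by
    intro l
    induction l with
    | nil => intro n acc; simp [Denumerable.raise]
    | cons m l ih => intro n acc; simp [Denumerable.raise, ih]
  simp [raiseList, this]

theorem primrec_raiseList : Primrec raiseList := by
  have h : Primrec fun p : List ℕ × ((ℕ × List ℕ) × ℕ) => p.2.2 + p.2.1.1 :=
    Primrec.nat_add.comp (Primrec.snd.comp Primrec.snd)
      (Primrec.fst.comp (Primrec.fst.comp Primrec.snd))
  have h' : Primrec₂ fun (_ : List ℕ) (p : (ℕ × List ℕ) × ℕ) =>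
      (p.2 + p.1.1, (p.2 + p.1.1) :: p.1.2) :=
    h.pair (Primrec.list_cons.comp h (Primrec.snd.comp (Primrec.fst.comp Primrec.snd)))
  exact Primrec.snd.comp (Primrec.list_foldl Primrec.id (Primrec.const (0, [])) h')

theorem primrec_list_count : Primrec₂ fun (l : List ℕ) x => l.count x := by
  have h : Primrec₂ fun (p : List ℕ × ℕ) (q : ℕ × ℕ) => if q.1 = p.2 then q.2 + 1 else q.2 :=
    Primrec.ite (Primrec.eq.comp (Primrec.fst.comp Primrec.snd) (Primrec.snd.comp Primrec.fst))
      (Primrec.succ.comp (Primrec.snd.comp Primrec.snd)) (Primrec.snd.comp Primrec.snd)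
  refine (Primrec.list_foldr Primrec.fst (Primrec.const 0) h).of_eq fun p => ?_
  obtain ⟨l, x⟩ := p
  induction l with
  | nil => rfl
  | cons y l ih =>
    simp only [List.foldr_cons, List.count_cons] at ih ⊢
    rw [ih]
    split_ifs <;> simp_all

/-- The association list with entries `x` and the rational whose code is the multiplicity of
`x`. -/
def Env.ofList (l : List ℕ) : Env := l.map fun x => (x, ratOfNat (l.count x))

theorem primrec_env_ofList : Primrec Env.ofList :=
  Primrec.list_map Primrec.id (Primrec.snd.pair (primrec_ratOfNat.comp primrec_list_count))

/-- Repeated entries for one variable agree, so it does not matter which one the lookup finds. A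
missing variable has multiplicity `0`, the code of the default value `0`. -/
theorem Env.val_ofList (l : List ℕ) (x : ℕ) : (Env.ofList l).val x = ratOfNat (l.count x) := by
  rw [Env.val, Env.ofList]
  by_cases h : x ∈ l
  · rw [List.lookup_graph (fun x => ratOfNat (l.count x)) h]; rfl
  · rw [List.count_eq_zero_of_not_mem h, List.lookup_eq_none_iff.2]
    · rw [ratOfNat]; rfl
    · simp only [List.mem_map, forall_exists_index, and_imp]
      rintro _ y hy rfl
      simpa using fun h' : x = y => h (h' ▸ hy)

/-- The code of a valuation is the code of a multiset, hence of the list of differences of its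
sorted elements; reading it as a list makes the conversion primitive recursive. -/
noncomputable def Env.ofVal (η : Val) : Env :=
  Env.ofList (raiseList (Denumerable.ofNat (List ℕ)
    (@Encodable.encode Val Primcodable.toEncodable η)))

theorem primrec_env_ofVal : Primrec Env.ofVal :=
  primrec_env_ofList.comp (primrec_raiseList.comp ((Primrec.ofNat (List ℕ)).comp Primrec.encode))

theorem ofNat_multiset (n : ℕ) : Denumerable.ofNat (Multiset ℕ) n =
    (Denumerable.raise (Denumerable.ofNat (List ℕ) n) 0 : Multiset ℕ) := by
  have h : Denumerable.ofNat (Multiset ℕ) n = Multiset.map (Denumerable.ofNat ℕ)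
      (Denumerable.raise (Denumerable.ofNat (List ℕ) n) 0 : Multiset ℕ) := rfl
  rw [h]
  exact (Multiset.map_congr rfl fun x _ => Denumerable.ofNat_nat x).trans (Multiset.map_id' _)

theorem Env.val_ofVal (η : Val) (x : ℕ) : (Env.ofVal η).val x = η x := by
  have h' : valEquiv η = (Denumerable.raise (Denumerable.ofNat (List ℕ)
      (@Encodable.encode Val Primcodable.toEncodable η)) 0 : Multiset ℕ) :=
    (Denumerable.ofNat_encode (valEquiv η)).symm.trans (ofNat_multiset _)
  rw [Env.ofVal, Env.val_ofList, raiseList_eq, List.count_reverse, ← Multiset.coe_count, ← h']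
  have : (valEquiv η).count x = ratCode (η x) := by
    rw [← Multiset.toFinsupp_apply]
    simp [valEquiv, ratEquiv]
  rw [this, ratOfNat_ratCode]

/-- The value of an expression as a difference of nonnegative rationals. -/
def AExp.signed (ρ : ℕ → ℚ≥0) : AExp → ℚ≥0 × ℚ≥0
  | const c => (c, 0)
  | var x => (ρ x, 0)
  | add e₁ e₂ => ((e₁.signed ρ).1 + (e₂.signed ρ).1, (e₁.signed ρ).2 + (e₂.signed ρ).2)
  | sub e₁ e₂ => ((e₁.signed ρ).1 + (e₂.signed ρ).2, (e₁.signed ρ).2 + (e₂.signed ρ).1)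
  | mul e₁ e₂ => ((e₁.signed ρ).1 * (e₂.signed ρ).1 + (e₁.signed ρ).2 * (e₂.signed ρ).2,
      (e₁.signed ρ).1 * (e₂.signed ρ).2 + (e₁.signed ρ).2 * (e₂.signed ρ).1)

theorem AExp.eval_eq_signed (η : Val) (e : AExp) :
    e.eval η = ((e.signed η).1 : ℚ) - (e.signed η).2 := by
  induction e with
  | const c => simp [eval, signed]
  | var x => simp [eval, signed]
  | add e₁ e₂ h₁ h₂ => rw [eval, signed, h₁, h₂]; push_cast; ring
  | sub e₁ e₂ h₁ h₂ => rw [eval, signed, h₁, h₂]; push_cast; ring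
  | mul e₁ e₂ h₁ h₂ => rw [eval, signed, h₁, h₂]; push_cast; ring

theorem AExp.toNNRat_eval (η : Val) (e : AExp) :
    (max (e.eval η) 0).toNNRat = (e.signed η).1 - (e.signed η).2 := by
  rw [NNRat.sub_def, ← e.eval_eq_signed]
  rcases le_total (e.eval η) 0 with h | h
  · rw [max_eq_right h, Rat.toNNRat_of_nonpos h]; simp
  · rw [max_eq_left h]

/-- Recursion on the code: the residue modulo `5` names the constructor and the quotient unpairs to
the codes of the operands. The recursive values are ignored for constants and variables. -/
theorem primrec_signed :
    Primrec₂ fun (l : Env) (n : ℕ) => (AExp.ofCode n).signed l.val := by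
  have hn : Primrec fun p : (Env × ℕ) × ((ℚ≥0 × ℚ≥0) × (ℚ≥0 × ℚ≥0)) => p.1.2 :=
    Primrec.snd.comp Primrec.fst
  have hm := Primrec.nat_mod.comp hn (Primrec.const 5)
  have hd := Primrec.nat_div.comp hn (Primrec.const 5)
  have hl : Primrec fun p : (Env × ℕ) × ((ℚ≥0 × ℚ≥0) × (ℚ≥0 × ℚ≥0)) => p.1.1 :=
    Primrec.fst.comp Primrec.fst
  have h₁ : Primrec fun p : (Env × ℕ) × ((ℚ≥0 × ℚ≥0) × (ℚ≥0 × ℚ≥0)) => p.2.1 :=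
    Primrec.fst.comp Primrec.snd
  have h₂ : Primrec fun p : (Env × ℕ) × ((ℚ≥0 × ℚ≥0) × (ℚ≥0 × ℚ≥0)) => p.2.2 :=
    Primrec.snd.comp Primrec.snd
  have h₁₁ := Primrec.fst.comp h₁
  have h₁₂ := Primrec.snd.comp h₁
  have h₂₁ := Primrec.fst.comp h₂
  have h₂₂ := Primrec.snd.comp h₂
  have h5 : Primrec fun n : ℕ => n / 5 := Primrec.nat_div.comp Primrec.id (Primrec.const 5)
  refine primrec_strong_rec₂ (G := fun p u => if p.2 % 5 = 0 then (ratOfNat (p.2 / 5), 0)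
    else if p.2 % 5 = 1 then (p.1.val (p.2 / 5), 0)
    else if p.2 % 5 = 2 then (u.1.1 + u.2.1, u.1.2 + u.2.2)
    else if p.2 % 5 = 3 then (u.1.1 + u.2.2, u.1.2 + u.2.1)
    else (u.1.1 * u.2.1 + u.1.2 * u.2.2, u.1.1 * u.2.2 + u.1.2 * u.2.1)) _ (0, 0)
    (primrec_unpair_fst.comp h5) (primrec_unpair_snd.comp h5) ?_ ?_
  · refine Primrec.ite (Primrec.eq.comp hm (Primrec.const 0)) ?_ (Primrec.ite
      (Primrec.eq.comp hm (Primrec.const 1)) ?_ (Primrec.ite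
      (Primrec.eq.comp hm (Primrec.const 2)) ?_ (Primrec.ite
      (Primrec.eq.comp hm (Primrec.const 3)) ?_ ?_)))
    · exact (primrec_ratOfNat.comp hd).pair (Primrec.const 0)
    · exact (primrec_env_val.comp hl hd).pair (Primrec.const 0)
    · exact (primrec_nnrat_add h₁₁ h₂₁).pair (primrec_nnrat_add h₁₂ h₂₂)
    · exact (primrec_nnrat_add h₁₁ h₂₂).pair (primrec_nnrat_add h₁₂ h₂₁)
    · exact (primrec_nnrat_add (primrec_nnrat_mul h₁₁ h₂₁) (primrec_nnrat_mul h₁₂ h₂₂)).pair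
        (primrec_nnrat_add (primrec_nnrat_mul h₁₁ h₂₂) (primrec_nnrat_mul h₁₂ h₂₁))
  · intro l n
    dsimp only
    rw [AExp.ofCode]
    by_cases h0 : n % 5 = 0
    · simp only [if_pos h0, AExp.signed]
    by_cases h1 : n % 5 = 1
    · simp only [if_neg h0, if_pos h1, AExp.signed]
    have i₁ : (n / 5).unpair.1 < n := unpair_fst_lt (by omega)
    have i₂ : (n / 5).unpair.2 < n := unpair_snd_lt (by omega)
    rw [if_pos i₁, if_pos i₂]
    split_ifs <;> rfl

/-- The truth value of a Boolean expression, computed without negative numbers. -/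
def BExp.holds (ρ : ℕ → ℚ≥0) : BExp → Bool
  | eq e₁ e₂ => (e₁.signed ρ).1 + (e₂.signed ρ).2 = (e₂.signed ρ).1 + (e₁.signed ρ).2
  | lt e₁ e₂ => (e₁.signed ρ).1 + (e₂.signed ρ).2 < (e₂.signed ρ).1 + (e₁.signed ρ).2
  | not b => !b.holds ρ
  | and b₁ b₂ => b₁.holds ρ && b₂.holds ρ

theorem BExp.eval_eq_holds (η : Val) (b : BExp) : b.eval η = b.holds η := by
  induction b with
  | eq e₁ e₂ =>
    rw [eval, holds, e₁.eval_eq_signed, e₂.eval_eq_signed, decide_eq_decide, sub_eq_sub_iff_add_eq_add]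
    norm_cast
  | lt e₁ e₂ =>
    rw [eval, holds, e₁.eval_eq_signed, e₂.eval_eq_signed, decide_eq_decide, sub_lt_sub_iff]
    norm_cast
  | not b h => rw [eval, holds, h]
  | and b₁ b₂ h₁ h₂ => rw [eval, holds, h₁, h₂]

theorem primrec_holds : Primrec₂ fun (l : Env) (n : ℕ) => (BExp.ofCode n).holds l.val := by
  have hn : Primrec fun p : (Env × ℕ) × (Bool × Bool) => p.1.2 := Primrec.snd.comp Primrec.fst
  have hm := Primrec.nat_mod.comp hn (Primrec.const 4)
  have hd := Primrec.nat_div.comp hn (Primrec.const 4)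
  have hl : Primrec fun p : (Env × ℕ) × (Bool × Bool) => p.1.1 := Primrec.fst.comp Primrec.fst
  have h₁ : Primrec fun p : (Env × ℕ) × (Bool × Bool) => p.2.1 := Primrec.fst.comp Primrec.snd
  have h₂ : Primrec fun p : (Env × ℕ) × (Bool × Bool) => p.2.2 := Primrec.snd.comp Primrec.snd
  have e₁ := primrec_signed.comp hl (primrec_unpair_fst.comp hd)
  have e₂ := primrec_signed.comp hl (primrec_unpair_snd.comp hd)
  have s₁ := primrec_nnrat_add (Primrec.fst.comp e₁) (Primrec.snd.comp e₂)
  have s₂ := primrec_nnrat_add (Primrec.fst.comp e₂) (Primrec.snd.comp e₁)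
  have h4 : Primrec fun n : ℕ => n / 4 := Primrec.nat_div.comp Primrec.id (Primrec.const 4)
  -- A negation has one operand, coded by the whole quotient instead of a component of it.
  have hs₁ : Primrec fun n : ℕ => if n % 4 = 2 then n / 4 else (n / 4).unpair.1 :=
    Primrec.ite (Primrec.eq.comp (Primrec.nat_mod.comp Primrec.id (Primrec.const 4))
      (Primrec.const 2)) h4 (primrec_unpair_fst.comp h4)
  refine primrec_strong_rec₂ (G := fun p u =>
    if p.2 % 4 = 0 then
      decide (((AExp.ofCode (p.2 / 4).unpair.1).signed p.1.val).1 +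
        ((AExp.ofCode (p.2 / 4).unpair.2).signed p.1.val).2 =
        ((AExp.ofCode (p.2 / 4).unpair.2).signed p.1.val).1 +
        ((AExp.ofCode (p.2 / 4).unpair.1).signed p.1.val).2)
    else if p.2 % 4 = 1 then
      decide (((AExp.ofCode (p.2 / 4).unpair.1).signed p.1.val).1 +
        ((AExp.ofCode (p.2 / 4).unpair.2).signed p.1.val).2 <
        ((AExp.ofCode (p.2 / 4).unpair.2).signed p.1.val).1 +
        ((AExp.ofCode (p.2 / 4).unpair.1).signed p.1.val).2)
    else if p.2 % 4 = 2 then !u.1 else u.1 && u.2) _ false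
    hs₁ (primrec_unpair_snd.comp h4) ?_ ?_
  · refine Primrec.ite (Primrec.eq.comp hm (Primrec.const 0)) ?_ (Primrec.ite
      (Primrec.eq.comp hm (Primrec.const 1)) ?_ (Primrec.ite
      (Primrec.eq.comp hm (Primrec.const 2)) (Primrec.not.comp h₁) (Primrec.and.comp h₁ h₂)))
    · exact primrecPred_iff_primrec_decide.1 (Primrec.eq.comp s₁ s₂)
    · exact primrecPred_iff_primrec_decide.1 (primrecPred_nnrat_lt s₁ s₂)
  · intro l n
    dsimp only
    rw [BExp.ofCode]
    by_cases h0 : n % 4 = 0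
    · simp only [if_pos h0, BExp.holds]
    by_cases h1 : n % 4 = 1
    · simp only [if_neg h0, if_pos h1, BExp.holds]
    by_cases h2 : n % 4 = 2
    · simp only [if_neg h0, if_neg h1, if_pos h2, BExp.holds, show n / 4 < n by omega, if_true]
    · simp only [if_neg h0, if_neg h1, if_neg h2, BExp.holds,
        show (n / 4).unpair.1 < n from unpair_fst_lt (by omega),
        show (n / 4).unpair.2 < n from unpair_snd_lt (by omega), if_true]

/-! ### Primitive recursive execution -/

/-- Embeds a remainder into a context of programs to be executed afterwards. -/
def Ctl.wrap (c : Ctl) (K : List ℕ) : Ctl := K.foldl (fun c n => Ctl.seq c (Prog.ofCode n)) c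

def State.wrap (K : List ℕ) (σ : State) : State := { σ with ctl := σ.ctl.wrap K }

/-- Only the innermost remainder acts, provided that it is not `↓`, for which the next program of
the context would be started instead. -/
theorem step_wrap {c : Ctl} (h : c ≠ Ctl.done) (K : List ℕ) (η : Val) (a : ℚ≥0) (θ : List Dir)
    (d : Option Dir) :
    State.step ⟨c.wrap K, η, a, θ⟩ d = (State.step ⟨c, η, a, θ⟩ d).map (State.wrap K) := by
  induction K generalizing c with
  | nil =>
    have : State.wrap [] = id := rfl
    rw [this, Option.map_id]
    rfl
  | cons n K ih =>
    rw [Ctl.wrap, List.foldl_cons, ← Ctl.wrap, ih (by simp)]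
    have := step_andThen (σ := ⟨c, η, a, θ⟩) h (Prog.ofCode n) d
    rw [State.andThen] at this
    rw [this, Option.map_map]
    rfl

/-- The code of the control of a machine configuration: a head, which is `0` for `↓` and `n + 1` for
the program with code `n`, and the codes of the programs to be executed afterwards. -/
abbrev Code : Type := ℕ × List ℕ

def Code.head (n : ℕ) : Ctl := if n = 0 then Ctl.done else Ctl.prog (Prog.ofCode (n - 1))

def Code.toCtl (c : Code) : Ctl := (head c.1).wrap c.2

/-- The head is a sequential composition. -/
def IsSeqHead (n : ℕ) : Prop := n ≠ 0 ∧ (n - 1) % 4 = 1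

instance (n : ℕ) : Decidable (IsSeqHead n) := inferInstanceAs (Decidable (_ ∧ _))

/-- Moves the second component of a sequential composition at the head to the context. -/
def Code.unfold (c : Code) : Code :=
  if IsSeqHead c.1 then
    (((c.1 - 1) / 4).unpair.1 + 1, ((c.1 - 1) / 4).unpair.2 :: c.2)
  else c

/-- Unfolding changes the state and is not a step of the semantics, but it preserves the successors
under every label. -/
theorem Code.step_unfold (c : Code) (η : Val) (a : ℚ≥0) (θ : List Dir) (d : Option Dir) :
    State.step ⟨c.unfold.toCtl, η, a, θ⟩ d = State.step ⟨c.toCtl, η, a, θ⟩ d := by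
  rw [unfold]
  split_ifs with h
  · obtain ⟨n, K⟩ := c
    obtain ⟨h0, h1⟩ := h
    dsimp only at h0 h1 ⊢
    have e : head n = Ctl.prog (.seq (Prog.ofCode ((n - 1) / 4).unpair.1)
        (Prog.ofCode ((n - 1) / 4).unpair.2)) := by
      rw [head, if_neg h0, Prog.ofCode, if_neg (by omega), if_pos h1]
    have l : toCtl (((n - 1) / 4).unpair.1 + 1, ((n - 1) / 4).unpair.2 :: K) =
        (Ctl.seq (Ctl.prog (Prog.ofCode ((n - 1) / 4).unpair.1))
          (Prog.ofCode ((n - 1) / 4).unpair.2)).wrap K := rfl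
    rw [l, toCtl, e, step_wrap (by simp), step_wrap (by simp)]
    rfl
  · rfl

theorem Code.step_iterate_unfold (m : ℕ) (c : Code) (η : Val) (a : ℚ≥0) (θ : List Dir)
    (d : Option Dir) :
    State.step ⟨(unfold^[m] c).toCtl, η, a, θ⟩ d = State.step ⟨c.toCtl, η, a, θ⟩ d := by
  induction m generalizing c with
  | zero => rfl
  | succ m ih => rw [Function.iterate_succ_apply, ih, step_unfold]

/-- Unfolding a sequential head strictly decreases it, so as many iterations as the head itself
suffice. -/
theorem Code.not_isSeqHead (m : ℕ) (c : Code) (h : c.1 ≤ m) : ¬ IsSeqHead (unfold^[m] c).1 := by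
  induction m generalizing c with
  | zero => exact fun h' => h'.1 (by simpa using h)
  | succ m ih =>
    rw [Function.iterate_succ_apply]
    by_cases hc : IsSeqHead c.1
    · refine ih _ ?_
      rw [unfold, if_pos hc]
      have := Nat.unpair_left_le ((c.1 - 1) / 4)
      obtain ⟨h0, h1⟩ := hc
      dsimp only
      omega
    · have hu : unfold c = c := if_neg hc
      rw [Function.iterate_fixed (by rw [hu]; exact hu), hu]
      exact hc

theorem Code.primrec_iterate_unfold : Primrec fun c : Code => unfold^[c.1] c := by
  have hn : Primrec fun c : Code => c.1 - 1 := Primrec.pred.comp Primrec.fst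
  have hd : Primrec fun c : Code => (c.1 - 1) / 4 := Primrec.nat_div.comp hn (Primrec.const 4)
  have h : Primrec unfold := by
    refine Primrec.ite (((Primrec.eq.comp Primrec.fst (Primrec.const 0)).not).and
      (Primrec.eq.comp (Primrec.nat_mod.comp hn (Primrec.const 4)) (Primrec.const 1))) ?_ Primrec.id
    exact (Primrec.succ.comp (primrec_unpair_fst.comp hd)).pair
      (Primrec.list_cons.comp (primrec_unpair_snd.comp hd) Primrec.snd)
  exact Primrec.nat_iterate Primrec.fst Primrec.id (h.comp Primrec.snd)

/-- Machine configurations. -/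
abbrev Config : Type := Code × Env × ℚ≥0

/-- The configurations after one step, if the head is not a sequential composition. -/
def Config.succ' (c : Config) : List Config :=
  -- With an empty stack the machine has terminated and `take 1` yields no successor; otherwise the
  -- first program of the stack is started.
  if c.1.1 = 0 then (c.1.2.take 1).map fun n => ((n + 1, c.1.2.tail), c.2)
  else if (c.1.1 - 1) % 4 = 0 then
    [((0, c.1.2), (((c.1.1 - 1) / 4).unpair.1,
      ((AExp.ofCode ((c.1.1 - 1) / 4).unpair.2).signed c.2.1.val).1 -
      ((AExp.ofCode ((c.1.1 - 1) / 4).unpair.2).signed c.2.1.val).2) :: c.2.1, c.2.2)]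
  else if (c.1.1 - 1) % 4 = 2 then
    [((((c.1.1 - 1) / 4).unpair.2.unpair.1 + 1, c.1.2), c.2.1,
      c.2.2 * (probOfNat ((c.1.1 - 1) / 4).unpair.1).1),
     ((((c.1.1 - 1) / 4).unpair.2.unpair.2 + 1, c.1.2), c.2.1,
      c.2.2 * (1 - (probOfNat ((c.1.1 - 1) / 4).unpair.1).1))]
  else if (BExp.ofCode ((c.1.1 - 1) / 4).unpair.1).holds c.2.1.val = true then
    [((((c.1.1 - 1) / 4).unpair.2 + 1, (c.1.1 - 1) :: c.1.2), c.2)]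
  else [((0, c.1.2), c.2)]

def Config.succ (c : Config) : List Config := succ' (Code.unfold^[c.1.1] c.1, c.2)

theorem Config.primrec_succ' : Primrec Config.succ' := by
  have hh : Primrec fun c : Config => c.1.1 := Primrec.fst.comp Primrec.fst
  have hK : Primrec fun c : Config => c.1.2 := Primrec.snd.comp Primrec.fst
  have hs : Primrec fun c : Config => c.2 := Primrec.snd
  have hl : Primrec fun c : Config => c.2.1 := Primrec.fst.comp hs
  have ha : Primrec fun c : Config => c.2.2 := Primrec.snd.comp hs
  have hn : Primrec fun c : Config => c.1.1 - 1 := Primrec.pred.comp hh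
  have hm : Primrec fun c : Config => (c.1.1 - 1) % 4 := Primrec.nat_mod.comp hn (Primrec.const 4)
  have hd : Primrec fun c : Config => (c.1.1 - 1) / 4 := Primrec.nat_div.comp hn (Primrec.const 4)
  have h₁ := primrec_unpair_fst.comp hd
  have h₂ := primrec_unpair_snd.comp hd
  have single : ∀ {f : Config → Config}, Primrec f → Primrec fun c => [f c] := fun hf =>
    Primrec.list_cons.comp hf (Primrec.const [])
  have he := primrec_signed.comp hl h₂
  have hv := primrec_nnrat_sub (Primrec.fst.comp he) (Primrec.snd.comp he)
  have hp := primrec_probOfNat.comp h₁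
  have h0 : Primrec₂ fun (c : Config) (n : ℕ) => (((n + 1, c.1.2.tail), c.2) : Config) :=
    ((Primrec.succ.comp Primrec.snd).pair (Primrec.list_tail.comp (hK.comp Primrec.fst))).pair
      (hs.comp Primrec.fst)
  have hloop : Primrec fun c : Config =>
      (BExp.ofCode ((c.1.1 - 1) / 4).unpair.1).holds c.2.1.val := primrec_holds.comp hl h₁
  refine Primrec.ite (Primrec.eq.comp hh (Primrec.const 0)) ?_ (Primrec.ite
    (Primrec.eq.comp hm (Primrec.const 0)) ?_ (Primrec.ite
    (Primrec.eq.comp hm (Primrec.const 2)) ?_ (Primrec.ite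
    (Primrec.eq.comp hloop (Primrec.const true)) ?_ ?_)))
  · exact Primrec.list_map (Primrec.list_take.comp (Primrec.const 1) hK) h0
  · exact single (((Primrec.const 0).pair hK).pair
      ((Primrec.list_cons.comp (h₁.pair hv) hl).pair ha))
  · exact Primrec.list_cons.comp
      (((Primrec.succ.comp (primrec_unpair_fst.comp h₂)).pair hK).pair
        (hl.pair (primrec_nnrat_mul ha hp)))
      (single (((Primrec.succ.comp (primrec_unpair_snd.comp h₂)).pair hK).pair
        (hl.pair (primrec_nnrat_mul ha (primrec_nnrat_sub (Primrec.const 1) hp)))))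
  · exact single (((Primrec.succ.comp h₂).pair (Primrec.list_cons.comp hn hK)).pair hs)
  · exact single (((Primrec.const 0).pair hK).pair hs)

theorem Config.primrec_succ : Primrec Config.succ :=
  primrec_succ'.comp ((Code.primrec_iterate_unfold.comp Primrec.fst).pair Primrec.snd)

/-- The configuration represents the state. -/
structure Represents (c : Config) (σ : State) : Prop where
  ctl : σ.ctl = c.1.toCtl
  val : ∀ x, σ.val x = c.2.1.val x
  prob : σ.prob = c.2.2

/-- The contribution of a terminal configuration to the expected outcome of `v`. -/
def Config.weight (v : ℕ) (c : Config) : ℚ≥0 :=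
  if c.1 = (0, []) then c.2.1.val v * c.2.2 else 0

/-- Summing over all successors replaces the sum over words, so no record of the choices is kept. -/
def Config.mass (v : ℕ) : ℕ → Config → ℚ≥0
  | 0, c => c.weight v
  | k + 1, c => (c.succ.map (mass v k)).sum

theorem Ctl.wrap_ne_done {c : Ctl} {K : List ℕ} (h : c ≠ Ctl.done ∨ K ≠ []) :
    c.wrap K ≠ Ctl.done := by
  induction K generalizing c with
  | nil => simpa [wrap] using h
  | cons n K ih => exact ih (Or.inl (by simp))

theorem Represents.weight_eq {c : Config} {σ : State} (h : Represents c σ) (v : ℕ) :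
    weight v (some σ) = c.weight v := by
  rw [Config.weight]
  split_ifs with hc
  · obtain ⟨ctl, η, a, θ⟩ := σ
    obtain ⟨h₁, h₂, h₃⟩ := h
    dsimp only at h₁ h₂ h₃
    rw [hc] at h₁
    subst h₁ h₃
    rw [← h₂]
    rfl
  · refine weight_eq_zero ?_ v
    rw [h.ctl]
    obtain ⟨⟨n, K⟩, l, a⟩ := c
    refine Ctl.wrap_ne_done ?_
    by_cases hn : n = 0
    · subst hn
      exact Or.inr fun hK => hc (by dsimp only at hK; rw [hK])
    · refine Or.inl ?_
      simp [Code.head, hn]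

theorem Ctl.step_done_wrap_cons (n : ℕ) (K : List ℕ) (η : Val) (a : ℚ≥0) (θ : List Dir) :
    State.step ⟨Ctl.done.wrap (n :: K), η, a, θ⟩ none =
      some ⟨(Ctl.prog (Prog.ofCode n)).wrap K, η, a, θ⟩ := by
  rw [wrap, List.foldl_cons, ← wrap, step_wrap (by simp)]
  rfl

/-- One case for each kind of head. Sequential heads are excluded, since they have to be unfolded
before `Config.succ'` applies. -/
theorem Represents.mass_succ' {c : Config} {σ : State} (h : Represents c σ)
    (hc : ¬ IsSeqHead c.1.1) (v k : ℕ)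
    (ih : ∀ {c σ}, Represents c σ → mass v k σ = c.mass v k) :
    mass v (k + 1) σ = (c.succ'.map (Config.mass v k)).sum := by
  obtain ⟨ctl, η, a, θ⟩ := σ
  obtain ⟨⟨n, K⟩, l, b⟩ := c
  obtain ⟨rfl, h₂, rfl⟩ : ctl = Code.toCtl (n, K) ∧ _ ∧ a = b := ⟨h.ctl, h.val, h.prob⟩
  dsimp only at h₂ hc ⊢
  have hη : (η : ℕ → ℚ≥0) = l.val := funext h₂
  rw [Config.succ']
  dsimp only
  by_cases hn : n = 0
  · subst hn
    rw [if_pos rfl]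
    cases K with
    | nil =>
      have hs : ∀ d, State.step ⟨Code.toCtl (0, []), η, a, θ⟩ d = none := fun d => rfl
      simp [mass_succ_of_step_none (hs none), hs]
    | cons n K =>
      refine (mass_succ_of_step (Ctl.step_done_wrap_cons n K η a θ) v k).trans ?_
      have hr : Represents ((n + 1, K), l, a)
        ⟨(Ctl.prog (Prog.ofCode n)).wrap K, η, a, θ⟩ := ⟨rfl, h₂, rfl⟩
      simp [ih hr]
  rw [if_neg hn]
  have hhead : Code.toCtl (n, K) = (Ctl.prog (Prog.ofCode (n - 1))).wrap K := by
    simp [Code.toCtl, Code.head, hn]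
  have hstep := step_wrap (c := Ctl.prog (Prog.ofCode (n - 1))) (by simp) K η a θ
  rw [← hhead] at hstep
  have h1 : (n - 1) % 4 ≠ 1 := fun h1 => hc ⟨hn, h1⟩
  split_ifs with m0 m2 hb
  · have e : Prog.ofCode (n - 1) = .assign ((n - 1) / 4).unpair.1
        (AExp.ofCode ((n - 1) / 4).unpair.2) := by
      rw [Prog.ofCode, if_pos m0]
    rw [e] at hstep
    rw [mass_succ_of_step (hstep none), ih (c := ((0, K), (((n - 1) / 4).unpair.1,
      ((AExp.ofCode ((n - 1) / 4).unpair.2).signed l.val).1 -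
      ((AExp.ofCode ((n - 1) / 4).unpair.2).signed l.val).2) :: l, a)) ⟨rfl, fun x => ?_, rfl⟩]
    · simp
    · rw [Env.val_cons, ← h₂, ← hη, ← AExp.toNNRat_eval]
      exact (congrFun (Finsupp.coe_update η _ _) x).trans (Function.update_apply _ _ _ x)
  · have e : Prog.ofCode (n - 1) = .choice (probOfNat ((n - 1) / 4).unpair.1)
        (Prog.ofCode ((n - 1) / 4).unpair.2.unpair.1)
        (Prog.ofCode ((n - 1) / 4).unpair.2.unpair.2) := by
      rw [Prog.ofCode, if_neg m0, if_neg h1, if_pos m2]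
    rw [e] at hstep
    have hL := hstep (some Dir.L)
    have hR := hstep (some Dir.R)
    simp only [State.step, Ctl.step, Prog.step, Option.map_some] at hL hR
    rw [mass_succ_of_step_none (hstep none)]
    simp only [State.step, hL, hR, Option.map_some, Option.getD_some, List.map_cons, List.map_nil,
      List.sum_cons, List.sum_nil, add_zero]
    congr 1
    · exact ih ⟨rfl, h₂, rfl⟩
    · exact ih ⟨rfl, h₂, rfl⟩
  all_goals
    have e : Prog.ofCode (n - 1) = .loop (BExp.ofCode ((n - 1) / 4).unpair.1)
        (Prog.ofCode ((n - 1) / 4).unpair.2) := by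
      rw [Prog.ofCode, if_neg m0, if_neg h1, if_neg m2]
    rw [e] at hstep
    rw [← hη, ← BExp.eval_eq_holds] at hb
    have hs := hstep none
  · rw [step_loop_true hb, ← e] at hs
    rw [mass_succ_of_step hs, ih (c := ((((n - 1) / 4).unpair.2 + 1, (n - 1) :: K), l, a))
      ⟨rfl, h₂, rfl⟩]
    simp
  · rw [step_loop_false (by simpa using hb)] at hs
    rw [mass_succ_of_step hs, ih (c := ((0, K), l, a)) ⟨rfl, h₂, rfl⟩]
    simp

/-- At positive lengths only the successors matter. This justifies replacing a state by its unfolded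
form. -/
theorem mass_succ_congr {σ τ : State} (h : ∀ d, σ.step d = τ.step d) (v k : ℕ) :
    mass v (k + 1) σ = mass v (k + 1) τ := by
  cases hτ : τ.step none with
  | some ρ => rw [mass_succ_of_step hτ, mass_succ_of_step ((h none).trans hτ)]
  | none => rw [mass_succ_of_step_none hτ, mass_succ_of_step_none ((h none).trans hτ), h, h]

theorem Represents.mass_eq {c : Config} {σ : State} (h : Represents c σ) (v k : ℕ) :
    mass v k σ = c.mass v k := by
  induction k generalizing c σ with
  | zero => rw [mass_zero, h.weight_eq]; rfl
  | succ k ih =>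
    rw [Config.mass, Config.succ]
    obtain ⟨ctl, η, a, θ⟩ := σ
    rw [mass_succ_congr (τ := ⟨(Code.unfold^[c.1.1] c.1).toCtl, η, a, θ⟩) fun d => by
      rw [Code.step_iterate_unfold, ← h.ctl]]
    exact mass_succ' (c := (Code.unfold^[c.1.1] c.1, c.2))
      (σ := ⟨(Code.unfold^[c.1.1] c.1).toCtl, η, a, θ⟩) ⟨rfl, h.val, h.prob⟩
      (Code.not_isSeqHead _ _ le_rfl) v k ih

/-! ### Membership -/

theorem primrec_list_sum : Primrec (List.sum : List ℚ≥0 → ℚ≥0) := by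
  have h : Primrec₂ fun (_ : List ℚ≥0) (p : ℚ≥0 × ℚ≥0) => p.1 + p.2 :=
    primrec_nnrat_add (Primrec.fst.comp Primrec.snd) (Primrec.snd.comp Primrec.snd)
  exact (Primrec.list_foldr Primrec.id (Primrec.const 0) h).of_eq fun l => rfl

/-- The branching recursion becomes a breadth-first iteration on lists of configurations, a form
that is visibly primitive recursive. -/
theorem Config.sum_mass (v k : ℕ) (L : List Config) :
    (L.map (mass v k)).sum = (((fun L => L.flatMap succ)^[k] L).map (weight v)).sum := by
  induction k generalizing L with
  | zero => rfl
  | succ k ih =>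
    rw [Function.iterate_succ_apply, ← ih]
    induction L with
    | nil => rfl
    | cons c L ihL =>
      rw [List.map_cons, List.sum_cons, ihL, List.flatMap_cons, List.map_append, List.sum_append,
        mass]

theorem Config.primrec_mass : Primrec fun p : (ℕ × Config) × ℕ => mass p.1.1 p.2 p.1.2 := by
  have hstep : Primrec fun L : List Config => L.flatMap succ :=
    Primrec.list_flatMap Primrec.id (primrec_succ.comp Primrec.snd)
  have hsingle : Primrec fun p : (ℕ × Config) × ℕ => [p.1.2] :=
    Primrec.list_cons.comp (Primrec.snd.comp Primrec.fst) (Primrec.const [])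
  have hL : Primrec fun p : (ℕ × Config) × ℕ => (fun L => L.flatMap succ)^[p.2] [p.1.2] :=
    Primrec.nat_iterate Primrec.snd hsingle (hstep.comp Primrec.snd)
  have hw : Primrec₂ fun (p : (ℕ × Config) × ℕ) (c : Config) => c.weight p.1.1 := by
    have hc : Primrec fun p : ((ℕ × Config) × ℕ) × Config => p.2 := Primrec.snd
    have hv : Primrec fun p : ((ℕ × Config) × ℕ) × Config => p.1.1.1 :=
      Primrec.fst.comp (Primrec.fst.comp Primrec.fst)
    refine Primrec.ite (Primrec.eq.comp (Primrec.fst.comp hc) (Primrec.const (0, []))) ?_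
      (Primrec.const 0)
    exact primrec_nnrat_mul (primrec_env_val.comp (Primrec.fst.comp (Primrec.snd.comp hc)) hv)
      (Primrec.snd.comp (Primrec.snd.comp hc))
  refine (primrec_list_sum.comp (Primrec.list_map hL hw)).of_eq fun p => ?_
  rw [← sum_mass]
  simp

/-- The configuration of the initial state. -/
noncomputable def Config.init (P : Prog) (η : Val) : Config := ((P.code + 1, []), Env.ofVal η, 1)

theorem represents_init (P : Prog) (η : Val) : Represents (Config.init P η) (initState P η) := by
  refine ⟨?_, fun x => (Env.val_ofVal η x).symm, rfl⟩
  simp [Config.init, Code.toCtl, Code.head, initState, Prog.ofCode_code, Ctl.wrap]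

theorem Config.primrec_init : Primrec fun p : Prog × Val => init p.1 p.2 :=
  ((Primrec.succ.comp ((Primrec.encode (α := Prog)).comp Primrec.fst)).pair
    (Primrec.const [])).pair ((primrec_env_ofVal.comp Primrec.snd).pair (Primrec.const 1))

/-- The contribution of the runs of length less than `N` to the expected outcome. -/
noncomputable def partialOutcome (P : Prog) (η : Val) (v : Var) (N : ℕ) : ℚ≥0 :=
  ∑ k ∈ Finset.range N, mass v k (initState P η)

theorem primrec_partialOutcome :
    Primrec fun p : (Prog × Val × Var) × ℕ => partialOutcome p.1.1 p.1.2.1 p.1.2.2 p.2 := by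
  have hc : Primrec fun p : (Prog × Val × Var) × ℕ => Config.init p.1.1 p.1.2.1 :=
    Config.primrec_init.comp ((Primrec.fst.comp Primrec.fst).pair
      (Primrec.fst.comp (Primrec.snd.comp Primrec.fst)))
  have hv : Primrec fun p : (Prog × Val × Var) × ℕ => p.1.2.2 :=
    Primrec.snd.comp (Primrec.snd.comp Primrec.fst)
  have h : Primrec₂ fun (p : (Prog × Val × Var) × ℕ) (k : ℕ) =>
      Config.mass p.1.2.2 k (Config.init p.1.1 p.1.2.1) :=
    Config.primrec_mass.comp (((hv.pair hc).comp Primrec.fst).pair Primrec.snd)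
  refine (primrec_list_sum.comp
    (Primrec.list_map (Primrec.list_range.comp Primrec.snd) h)).of_eq fun p => ?_
  simp only [← (represents_init _ _).mass_eq]
  rfl

theorem expectedOutcome_eq_iSup (P : Prog) (η : Val) (v : Var) :
    expectedOutcome P η v = ⨆ N, ((partialOutcome P η v N : ℝ≥0) : ℝ≥0∞) := by
  rw [expectedOutcome_eq, outcome, ENNReal.tsum_eq_iSup_nat]
  refine iSup_congr fun N => ?_
  rw [partialOutcome]
  push_cast
  rfl

/-- A bound strictly below `q` is essential: partial sums that are all below `q` could still
converge to `q`. Density of the rationals provides it. -/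
theorem expectedOutcome_lt_iff (P : Prog) (η : Val) (v : Var) (q : ℚ≥0) :
    expectedOutcome P η v < ((q : ℝ≥0) : ℝ≥0∞) ↔
      ∃ r, ∀ N, ratOfNat r < q ∧ partialOutcome P η v N ≤ ratOfNat r := by
  have hle : ∀ (r : ℚ≥0) N, ((partialOutcome P η v N : ℝ≥0) : ℝ≥0∞) ≤ ((r : ℝ≥0) : ℝ≥0∞) ↔
      partialOutcome P η v N ≤ r := fun r N => by
    rw [ENNReal.coe_le_coe, NNRat.cast_le]
  rw [expectedOutcome_eq_iSup]
  constructor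
  · intro h
    obtain ⟨r, h₁, h₂⟩ := ENNReal.lt_iff_exists_nnreal_btwn.1 h
    obtain ⟨s, hs₁, hs₂⟩ := exists_rat_btwn (NNReal.coe_lt_coe.2 (ENNReal.coe_lt_coe.1 h₂))
    lift s to ℚ≥0 using by exact_mod_cast (r.coe_nonneg.trans_lt hs₁).le
    have hs₁ : r < (s : ℝ≥0) := by exact_mod_cast hs₁
    have hq : ((q : ℝ≥0) : ℝ) = (q : ℝ) := rfl
    rw [hq] at hs₂
    have hs₂ : s < q := by exact_mod_cast hs₂
    refine ⟨ratCode s, fun N => ?_⟩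
    rw [ratOfNat_ratCode]
    refine ⟨hs₂, (hle s N).1 ?_⟩
    exact ((le_iSup _ N).trans h₁.le).trans (ENNReal.coe_le_coe.2 hs₁.le)
  · rintro ⟨r, h⟩
    refine (iSup_le fun N => (hle _ N).2 (h N).2).trans_lt ?_
    rw [ENNReal.coe_lt_coe, NNRat.cast_lt]
    -- The condition `ratOfNat r < q` does not involve `N`, so any instance will do.
    exact (h 0).1

theorem isSigma2_REXP : IsSigma2 REXP := by
  refine ⟨fun x r N => ratOfNat r < x.2.2.2 ∧ partialOutcome x.1 x.2.1 x.2.2.1 N ≤ ratOfNat r, ?_,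
    fun x => expectedOutcome_lt_iff _ _ _ _⟩
  have hr : Primrec fun t : (Prog × Val × Var × ℚ≥0) × ℕ × ℕ => ratOfNat t.2.1 :=
    primrec_ratOfNat.comp (Primrec.fst.comp Primrec.snd)
  have hx : Primrec fun t : (Prog × Val × Var × ℚ≥0) × ℕ × ℕ => t.1.2.2 :=
    Primrec.snd.comp (Primrec.snd.comp Primrec.fst)
  have hp : Primrec fun t : (Prog × Val × Var × ℚ≥0) × ℕ × ℕ =>
      (((t.1.1, t.1.2.1, t.1.2.2.1), t.2.2) : (Prog × Val × Var) × ℕ) :=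
    ((Primrec.fst.comp Primrec.fst).pair ((Primrec.fst.comp (Primrec.snd.comp Primrec.fst)).pair
      (Primrec.fst.comp hx))).pair (Primrec.snd.comp Primrec.snd)
  exact ((primrecPred_nnrat_lt hr (Primrec.snd.comp hx)).and
    (primrecPred_nnrat_le (primrec_partialOutcome.comp hp) hr)).computablePred

end PGCL

theorem mainTheorem6 :
    PGCL.IsSigma2Complete PGCL.REXP ∧ ¬ REPred (fun x => x ∈ PGCL.REXP) :=
  ⟨⟨PGCL.isSigma2_REXP, PGCL.isSigma2Hard_REXP⟩,
    PGCL.not_rePred_of_isSigma2Hard PGCL.isSigma2Hard_REXP⟩
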